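/- Let $G$ be an (additively written) abelian group and let $\mathcal{B}(G)$ be the monoid of zero-sum sequences over $G$, i.e. the submonoid of the free abelian monoid $\mathcal{F}(G)$ with basis $G$ consisting of all formal products $g_1\cdots g_k$ ($k\ge 0$, $g_i\in G$) with $g_1+\dots+g_k=0$. For a commutative cancellative monoid $H$ and $a\in H$, let $\mathsf{L}_H(a)$ be the set of all $\ell\in\mathbb{N}_0$ such that $a$ is, up to an invertible factor, a product of $\ell$ irreducible elements of $H$. Let $\Delta(H)$ be the set of all positive integers $l-k$ such that, for some $a\in H$, the integers $k<l$ are consecutive elements of $\mathsf{L}_H(a)$. A submonoid $S\subset H$ is divisor closed if every divisor in $H$ of an element of $S$ lies in $S$. Put \[ \Delta^{\ast}(H)=\{\min\Delta(S)\colon S\subset H\text{ a divisor-closed submonoid},\ \Delta(S)\ne\emptyset\},\qquad \Delta^{\ast}(G)=\Delta^{\ast}(\mathcal{B}(G)). \] **Theorem.** Let $G$ be a finite cyclic group of order $|G|\ge 250$. Then, with $\mathbb{N}$ the set of positive integers, \[ \Delta^{\ast}(G)\cap\{d\in\mathbb{N}\colon d\ge |G|/5\} =\mathbb{N}\cap\Bigl\{|G|-2,\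 \tfrac{|G|-2}{2},\ \tfrac{|G|-3}{2},\ \tfrac{|G|-4}{2},\ \tfrac{|G|-4}{3},\ \tfrac{|G|-6}{3},\ \tfrac{|G|-4}{4},\ \tfrac{|G|-5}{4},\ \tfrac{|G|-6}{4},\ \tfrac{|G|-8}{4}\Bigr\}. \] -/

import Mathlib

namespace Factorization

/-- The set of lengths `L_H(a)`: all `ℓ` such that `a` has, up to a unit, a factorization into
`ℓ` irreducible elements of the commutative monoid `H` (so units have set of lengths `{0}`). -/
def lengths {H : Type*} [CommMonoid H] (a : H) : Set ℕ :=
  {l | ∃ z : Multiset H,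
    (∀ u ∈ z, Irreducible u) ∧ Associated z.prod a ∧ Multiset.card z = l}

/-- The set of successive distances of a set `L` of non-negative integers. -/
def succDistances (L : Set ℕ) : Set ℕ :=
  {d | ∃ k ∈ L, ∃ l ∈ L, k < l ∧ (∀ m ∈ L, ¬(k < m ∧ m < l)) ∧ d = l - k}

/-- The set of distances `Δ(H)` of a commutative monoid `H`. -/
def distances (H : Type*) [CommMonoid H] : Set ℕ :=
  ⋃ a : H, succDistances (lengths a)

/-- `S ⊆ H` is a divisor-closed submonoid. -/
def IsDivisorClosed {H : Type*} [CommMonoid H] (S : Submonoid H) : Prop :=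
  ∀ a ∈ S, ∀ b : H, b ∣ a → b ∈ S

/-- The set of minimal distances `Δ*(H)`: all `min Δ(S)`, where `S` runs over the divisor-closed
submonoids of `H` with `Δ(S) ≠ ∅`. (`IsLeast` includes that `Δ(S)` is non-empty.) -/
def minDistances (H : Type*) [CommMonoid H] : Set ℕ :=
  {d | ∃ S : Submonoid H, IsDivisorClosed S ∧ IsLeast (distances S) d}

/-- The monoid `B(G)` of zero-sum sequences over `G`, a submonoid of the free abelian monoid
with basis `G` (finite multisets of elements of `G`, written multiplicatively). -/
def zeroSumSequences (G : Type*) [AddCommGroup G] : Submonoid (Multiplicative (Multiset G)) where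
  carrier := {S | (Multiplicative.toAdd S).sum = 0}
  one_mem' := by simp
  mul_mem' := by
    intro S T hS hT
    change (Multiplicative.toAdd S).sum = 0 at hS
    change (Multiplicative.toAdd T).sum = 0 at hT
    change (Multiplicative.toAdd (S * T)).sum = 0
    rw [toAdd_mul, Multiset.sum_add, hS, hT, add_zero]

/-- `Δ*(G) = Δ*(B(G))` for an abelian group `G`. -/
def groupMinDistances (G : Type*) [AddCommGroup G] : Set ℕ :=
  minDistances (zeroSumSequences G)

end Factorization

/-! Divisor-closed submonoids of `B(G)` are the monoids `B(G₀)` with `G₀ ⊆ G`, and the least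
distance of `B(G₀)` is also the gcd of all differences of lengths. So `d` is a minimal distance
exactly when, for some `G₀`, all lengths of one element agree modulo `d` and the difference `d`
occurs (`mem_groupMinDistances_iff`). Every explicit pair of factorizations over `G₀` then gives a
multiple of `d`.

Let n = |G| ≤ 5d. For g, h in `G₀` take the least j > 0 with jh in ⟨g⟩ and write jh = ag with 0 < a
≤ ord g. If a does not divide ord g = qa + r, an identity between powers of minimal zero-sum
sequences over {g, h} gives d ∣ ⌈a/r⌉ - 1 (`hasLengthGap_pair`). As d is large, q, r, n / ord g and
the quotient (⌈a/r⌉ - 1)/d have product at most 4. A finite check leaves the listed values and a few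
pairs {e, ae} with e a generator (`isLargeMinDistance_or_isExceptionalPair`).

If a always divides ord g, then elements of `G₀` are determined by their orders and all cross
numbers are integers. This forces d < 2τ(n) ≤ n/5, with τ(n) the number of divisors of n
(`PairwiseDivisor.lt_two_mul_card_divisors`, `ten_mul_card_divisors_le`), a contradiction.

In an exceptional pair, either one more sequence yields a difference not divisible by d, or the rest
of `G₀` is so restricted that all lengths agree modulo a proper multiple of d
(`LengthsCongr.false_of_neg_mem`, `LengthsCongr.false_of_neg_two_nsmul_mem`).

Conversely, the listed values come from {f, mf} with ord f = cm + 1, which gives m - 1, and from {e,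
-e, ue} with ord e = 2u, which gives u - 1, inside subgroups of small index. -/

namespace Factorization

open Multiset

/-- A minimal zero-sum sequence, written as a multiset. -/
def IsMinZeroSum {G : Type*} [AddCommGroup G] (A : Multiset G) : Prop :=
  A ≠ 0 ∧ A.sum = 0 ∧ ∀ B ≤ A, B.sum = 0 → B = 0 ∨ B = A

/-- A family of minimal zero-sum sequences over `G₀`, that is, a factorization in `B(G₀)`. -/
def IsFactorization {G : Type*} [AddCommGroup G] (G₀ : Set G) (z : Multiset (Multiset G)) : Prop :=
  ∀ A ∈ z, IsMinZeroSum A ∧ ∀ g ∈ A, g ∈ G₀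

/-- Any two factorizations over `G₀` of the same element have congruent lengths modulo `d`. -/
def LengthsCongr {G : Type*} [AddCommGroup G] (G₀ : Set G) (d : ℕ) : Prop :=
  ∀ z z', IsFactorization G₀ z → IsFactorization G₀ z' → z.sum = z'.sum →
    (card z : ℤ) ≡ card z' [ZMOD d]

/-- Some element of `B(G₀)` has two factorizations whose lengths differ by `d`. -/
def HasLengthGap {G : Type*} [AddCommGroup G] (G₀ : Set G) (d : ℕ) : Prop :=
  ∃ z z', IsFactorization G₀ z ∧ IsFactorization G₀ z' ∧ z.sum = z'.sum ∧ card z' = card z + d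

/-- The set of lengths of a sequence over `G₀`. -/
def seqLengths {G : Type*} [AddCommGroup G] (G₀ : Set G) (B : Multiset G) : Set ℕ :=
  {l | ∃ z, IsFactorization G₀ z ∧ z.sum = B ∧ card z = l}

/-! ### From divisor-closed submonoids to subsets of the group -/

section Translation

variable {G : Type*} [AddCommGroup G] {G₀ : Set G}

theorem IsFactorization.add {z z' : Multiset (Multiset G)} (h : IsFactorization G₀ z)
    (h' : IsFactorization G₀ z') : IsFactorization G₀ (z + z') := by
  intro A hA
  rcases Multiset.mem_add.1 hA with hA | hA
  exacts [h A hA, h' A hA]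

theorem IsFactorization.nsmul {z : Multiset (Multiset G)} (h : IsFactorization G₀ z) (n : ℕ) :
    IsFactorization G₀ (n • z) := fun A hA => h A (Multiset.mem_of_mem_nsmul hA)

theorem IsFactorization.cons {z : Multiset (Multiset G)} (h : IsFactorization G₀ z)
    {A : Multiset G} (hA : IsMinZeroSum A) (hA' : ∀ g ∈ A, g ∈ G₀) :
    IsFactorization G₀ (A ::ₘ z) := by
  intro B hB
  rcases Multiset.mem_cons.1 hB with rfl | hB
  exacts [⟨hA, hA'⟩, h B hB]

theorem isFactorization_replicate (n : ℕ) {A : Multiset G} (hA : IsMinZeroSum A)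
    (hA' : ∀ g ∈ A, g ∈ G₀) : IsFactorization G₀ (replicate n A) := by
  intro B hB
  rw [Multiset.eq_of_mem_replicate hB]
  exact ⟨hA, hA'⟩

theorem IsFactorization.mono {G₁ : Set G} {z : Multiset (Multiset G)} (h : IsFactorization G₀ z)
    (hs : G₀ ⊆ G₁) : IsFactorization G₁ z := fun A hA => ⟨(h A hA).1, fun g hg => hs ((h A hA).2 g hg)⟩

theorem sum_eq_zero_and_mem {z : Multiset (Multiset G)} (h : IsFactorization G₀ z) :
    z.sum.sum = 0 ∧ ∀ g ∈ z.sum, g ∈ G₀ := by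
  induction z using Multiset.induction_on with
  | empty => simp
  | cons A z ih =>
    have hz := ih (fun B hB => h B (Multiset.mem_cons_of_mem hB))
    have hA := h A (Multiset.mem_cons_self A z)
    simp only [Multiset.sum_cons, Multiset.sum_add, Multiset.mem_add]
    refine ⟨by rw [hA.1.2.1, hz.1, add_zero], ?_⟩
    rintro g (hg | hg)
    exacts [hA.2 g hg, hz.2 g hg]

theorem exists_factorization (B : Multiset G) (hB : B.sum = 0) (hB' : ∀ g ∈ B, g ∈ G₀) :
    ∃ z, IsFactorization G₀ z ∧ z.sum = B := by
  induction B using Multiset.strongInductionOn with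
  | _ B ih =>
    by_cases h0 : B = 0
    · exact ⟨0, fun A hA => by simp at hA, by simp [h0]⟩
    by_cases hmin : IsMinZeroSum B
    · exact ⟨{B}, fun A hA => by rw [Multiset.mem_singleton.1 hA]; exact ⟨hmin, hB'⟩, by simp⟩
    · simp only [IsMinZeroSum, not_and, not_forall, not_or] at hmin
      obtain ⟨C, hC, hCs, hC0, hCB⟩ := hmin h0 hB
      obtain ⟨D, rfl⟩ := Multiset.le_iff_exists_add.1 hC
      have hD : D.sum = 0 := by rwa [Multiset.sum_add, hCs, zero_add] at hB
      have hD0 : D ≠ 0 := fun h => hCB (by simp [h])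
      obtain ⟨z, hz, hzs⟩ := ih C (lt_of_le_of_ne hC hCB) hCs
        (fun g hg => hB' g (Multiset.mem_add.2 (Or.inl hg)))
      obtain ⟨z', hz', hzs'⟩ := ih D (lt_of_le_of_ne (Multiset.le_add_left D C)
        (fun h => hC0 (by simpa using h))) hD
        (fun g hg => hB' g (Multiset.mem_add.2 (Or.inr hg)))
      exact ⟨z + z', hz.add hz', by rw [Multiset.sum_add, hzs, hzs']⟩

theorem exists_succDistance_le {L : Set ℕ} {k l : ℕ} (hk : k ∈ L) (hl : l ∈ L) (hkl : k < l) :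
    ∃ d ∈ succDistances L, d ≤ l - k := by
  classical
  have hex : ∃ m, m ∈ L ∧ k < m := ⟨l, hl, hkl⟩
  obtain ⟨h1, h2⟩ := Nat.find_spec hex
  refine ⟨Nat.find hex - k, ⟨k, hk, _, h1, h2, ?_, rfl⟩, ?_⟩
  · rintro m hm ⟨hm1, hm2⟩
    exact Nat.find_min hex hm2 ⟨hm, hm1⟩
  · have := Nat.find_min' hex ⟨hl, hkl⟩
    omega

/-- The minimum of the distances divides every difference of lengths, since a remainder could be
realised as a smaller difference. -/
theorem isLeast_iUnion_succDistances_iff {d : ℕ} :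
    IsLeast (⋃ B : Multiset G, succDistances (seqLengths G₀ B)) d ↔
      0 < d ∧ LengthsCongr G₀ d ∧ HasLengthGap G₀ d := by
  constructor
  · rintro ⟨hd, hmin⟩
    obtain ⟨B, k, ⟨z₁, hz₁, hs₁, hc₁⟩, l, ⟨z₂, hz₂, hs₂, hc₂⟩, hkl, -, hdl⟩ := Set.mem_iUnion.1 hd
    have hd0 : 0 < d := by omega
    refine ⟨hd0, ?_, z₁, z₂, hz₁, hz₂, by rw [hs₁, hs₂], by omega⟩
    have key : ∀ z z', IsFactorization G₀ z → IsFactorization G₀ z' → z.sum = z'.sum →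
        card z ≤ card z' → d ∣ card z' - card z := by
      intro z z' hz hz' hs hle
      by_contra hnd
      have hr : 0 < (card z' - card z) % d :=
        Nat.pos_of_ne_zero fun h => hnd (Nat.dvd_of_mod_eq_zero h)
      have hrd := Nat.mod_lt (card z' - card z) hd0
      have hdm := Nat.div_add_mod (card z' - card z) d
      -- Multiply by q copies of the pair realising d, crosswise: the two new lengths of one element
      -- differ by r < d, against minimality.
      set q := (card z' - card z) / d
      set r := (card z' - card z) % d
      have e1 : card (q • z₂ + z) = q * k + q * d + card z := by
        rw [Multiset.card_add, Multiset.card_nsmul, hc₂, ← mul_add]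
        congr 2; omega
      have e2 : card (q • z₁ + z') = q * k + card z' := by
        rw [Multiset.card_add, Multiset.card_nsmul, hc₁]
      have e3 : (q • z₁ + z').sum = (q • z₂ + z).sum := by
        rw [Multiset.sum_add, Multiset.sum_add, Multiset.sum_nsmul, Multiset.sum_nsmul, hs₁, hs₂, hs]
      have e4 : q * d = d * q := mul_comm _ _
      obtain ⟨d', hd', hle'⟩ := exists_succDistance_le
        (L := seqLengths G₀ (q • z₂ + z).sum)
        ⟨_, (hz₂.nsmul q).add hz, rfl, rfl⟩ ⟨_, (hz₁.nsmul q).add hz', e3, rfl⟩ (by omega)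
      have := hmin (Set.mem_iUnion.2 ⟨_, hd'⟩)
      omega
    intro z z' hz hz' hs
    rcases le_total (card z) (card z') with h | h
    · rw [Int.modEq_iff_dvd]
      have := key z z' hz hz' hs h
      zify [h] at this
      exact this
    · apply Int.ModEq.symm
      rw [Int.modEq_iff_dvd]
      have := key z' z hz' hz hs.symm h
      zify [h] at this
      exact this
  · rintro ⟨hd0, hcong, z, z', hz, hz', hs, hc⟩
    constructor
    · refine Set.mem_iUnion.2 ⟨z.sum, card z, ⟨z, hz, rfl, rfl⟩, card z', ⟨z', hz', hs.symm, rfl⟩,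
        by omega, ?_, by omega⟩
      rintro m ⟨y, hy, hys, rfl⟩ ⟨h1, h2⟩
      have := Int.modEq_iff_dvd.1 (hcong z y hz hy hys.symm)
      have := Int.le_of_dvd (by omega) this
      omega
    · intro d' hd'
      obtain ⟨B, k, ⟨z₁, hz₁, hs₁, hc₁⟩, l, ⟨z₂, hz₂, hs₂, hc₂⟩, hkl, -, hdl⟩ :=
        Set.mem_iUnion.1 hd'
      have := Int.modEq_iff_dvd.1 (hcong z₁ z₂ hz₁ hz₂ (hs₁.trans hs₂.symm))
      have := Int.le_of_dvd (by omega) this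
      omega

/-! ### Abstract monoids that are copies of the zero-sum sequences over a set -/

section Model

variable {M : Type*} [CommMonoid M] (φ : M →* Multiplicative (Multiset G))
  (hφ : Function.Injective φ)
  (hr : ∀ B : Multiset G, (∃ x, φ x = Multiplicative.ofAdd B) ↔ B.sum = 0 ∧ ∀ g ∈ B, g ∈ G₀)

include hφ in
omit [AddCommGroup G] in
theorem isUnit_iff_of_injective (x : M) : IsUnit x ↔ (φ x).toAdd = 0 := by
  constructor
  · intro hx
    obtain ⟨y, hy⟩ := hx.exists_right_inv
    have := congrArg (fun t => (φ t).toAdd) hy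
    simp only [map_mul, map_one, toAdd_mul, toAdd_one] at this
    exact (add_eq_zero.1 this).1
  · intro hx
    have : x = 1 := hφ (by rw [map_one]; exact hx)
    rw [this]; exact isUnit_one

include hφ in
omit [AddCommGroup G] in
theorem associated_iff_eq_of_injective (x y : M) : Associated x y ↔ x = y := by
  constructor
  · rintro ⟨u, rfl⟩
    have hu := (isUnit_iff_of_injective φ hφ (u : M)).1 u.isUnit
    apply hφ
    rw [map_mul]
    apply Multiplicative.toAdd.injective
    rw [toAdd_mul, hu, add_zero]
  · rintro rfl; rfl

include hφ hr in
theorem irreducible_iff_isMinZeroSum (x : M) : Irreducible x ↔ IsMinZeroSum (φ x).toAdd := by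
  have hx := (hr (φ x).toAdd).1 ⟨x, rfl⟩
  rw [irreducible_iff, isUnit_iff_of_injective φ hφ]
  constructor
  · rintro ⟨h0, h⟩
    refine ⟨h0, hx.1, fun B hB hBs => ?_⟩
    obtain ⟨C, hC⟩ := Multiset.le_iff_exists_add.1 hB
    obtain ⟨b, hb⟩ := (hr B).2 ⟨hBs, fun g hg => hx.2 g (Multiset.mem_of_le hB hg)⟩
    obtain ⟨c, hc⟩ := (hr C).2 ⟨by
      have := hx.1
      rwa [hC, Multiset.sum_add, hBs, zero_add] at this, fun g hg => hx.2 g (by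
        rw [hC]; exact Multiset.mem_add.2 (Or.inr hg))⟩
    have hbc : x = b * c := hφ (by
      rw [map_mul, hb, hc, ← ofAdd_add, ← hC]; rfl)
    rcases h hbc with h | h
    · left
      rw [isUnit_iff_of_injective φ hφ, hb] at h
      exact h
    · right
      rw [isUnit_iff_of_injective φ hφ, hc] at h
      rw [hC]
      change C = 0 at h
      rw [h, add_zero]
  · rintro ⟨h0, -, h⟩
    refine ⟨h0, fun b c hbc => ?_⟩
    rw [isUnit_iff_of_injective φ hφ, isUnit_iff_of_injective φ hφ]
    have e : (φ x).toAdd = (φ b).toAdd + (φ c).toAdd := by rw [hbc, map_mul, toAdd_mul]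
    rcases h (φ b).toAdd (by rw [e]; exact Multiset.le_add_right _ _)
      ((hr (φ b).toAdd).1 ⟨b, rfl⟩).1 with h | h
    · exact Or.inl h
    · right
      rw [e] at h
      simpa using h.symm

include hφ hr in
theorem lengths_eq_seqLengths (x : M) : lengths x = seqLengths G₀ (φ x).toAdd := by
  have hprod : ∀ z : Multiset M, (φ z.prod).toAdd = (z.map fun u => (φ u).toAdd).sum := by
    intro z
    induction z using Multiset.induction_on with
    | empty => simp
    | cons u z ih => simp [ih]
  ext l
  constructor
  · rintro ⟨z, hz, hzx, hzl⟩
    rw [associated_iff_eq_of_injective φ hφ] at hzx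
    refine ⟨z.map fun u => (φ u).toAdd, ?_, by rw [← hprod, hzx], by simpa using hzl⟩
    intro A hA
    obtain ⟨u, hu, rfl⟩ := Multiset.mem_map.1 hA
    exact ⟨(irreducible_iff_isMinZeroSum φ hφ hr u).1 (hz u hu), ((hr _).1 ⟨u, rfl⟩).2⟩
  · rintro ⟨z, hz, hzx, hzl⟩
    have : ∃ y : Multiset M, (y.map fun u => (φ u).toAdd) = z := by
      clear hzx hzl
      induction z using Multiset.induction_on with
      | empty => exact ⟨0, rfl⟩
      | cons A z ih =>
        obtain ⟨y, hy⟩ := ih (fun B hB => hz B (Multiset.mem_cons_of_mem hB))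
        have hA := hz A (Multiset.mem_cons_self A z)
        obtain ⟨u, hu⟩ := (hr A).2 ⟨hA.1.2.1, hA.2⟩
        exact ⟨u ::ₘ y, by rw [Multiset.map_cons, hy, hu]; rfl⟩
    obtain ⟨y, rfl⟩ := this
    refine ⟨y, fun u hu => ?_, ?_, by simpa using hzl⟩
    · rw [irreducible_iff_isMinZeroSum φ hφ hr]
      exact (hz _ (Multiset.mem_map_of_mem _ hu)).1
    · rw [associated_iff_eq_of_injective φ hφ]
      apply hφ
      apply Multiplicative.toAdd.injective
      rw [hprod, hzx]

include hφ hr in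
theorem isLeast_distances_iff {d : ℕ} :
    IsLeast (distances M) d ↔ 0 < d ∧ LengthsCongr G₀ d ∧ HasLengthGap G₀ d := by
  rw [← isLeast_iUnion_succDistances_iff]
  have : distances M = ⋃ B : Multiset G, succDistances (seqLengths G₀ B) := by
    ext t
    simp only [distances, Set.mem_iUnion]
    constructor
    · rintro ⟨x, hx⟩
      rw [lengths_eq_seqLengths φ hφ hr] at hx
      exact ⟨_, hx⟩
    · rintro ⟨B, hB⟩
      obtain ⟨k, ⟨z, hz, hzs, -⟩, -⟩ := id hB
      obtain ⟨x, hx⟩ := (hr B).2 (by rw [← hzs]; exact sum_eq_zero_and_mem hz)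
      refine ⟨x, ?_⟩
      rw [lengths_eq_seqLengths φ hφ hr, hx]
      exact hB
  rw [this]

end Model

theorem mem_groupMinDistances_iff {d : ℕ} :
    d ∈ groupMinDistances G ↔
      ∃ G₀ : Set G, 0 < d ∧ LengthsCongr G₀ d ∧ HasLengthGap G₀ d := by
  have hinj : ∀ S : Submonoid (zeroSumSequences G), Function.Injective
      ((zeroSumSequences G).subtype.comp S.subtype) := fun S =>
    Subtype.val_injective.comp Subtype.val_injective
  constructor
  · rintro ⟨S, hS, hd⟩
    refine ⟨{g | ∃ x ∈ S, g ∈ (x : Multiplicative (Multiset G)).toAdd}, ?_⟩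
    refine (isLeast_distances_iff ((zeroSumSequences G).subtype.comp S.subtype) (hinj S) ?_).1 hd
    intro B
    constructor
    · rintro ⟨x, hx⟩
      have hx' : B = (x : zeroSumSequences G).1.toAdd := congrArg Multiplicative.toAdd hx.symm
      subst hx'
      exact ⟨x.1.2, fun g hg => ⟨x.1, x.2, hg⟩⟩
    · rintro ⟨hB, hBm⟩
      -- Multiply one member of `S` for each term of B. The complement of B in the product has sum
      -- zero too, so B divides the product, and divisor-closedness puts B in `S`.
      have : ∃ y ∈ S, B ≤ (y : Multiplicative (Multiset G)).toAdd := by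
        clear hB
        induction B using Multiset.induction_on with
        | empty => exact ⟨1, S.one_mem, Multiset.zero_le _⟩
        | cons g B ih =>
          obtain ⟨y, hy, hBy⟩ := ih (fun k hk => hBm k (Multiset.mem_cons_of_mem hk))
          obtain ⟨x, hx, hgx⟩ := hBm g (Multiset.mem_cons_self g B)
          refine ⟨x * y, S.mul_mem hx hy, ?_⟩
          rw [← Multiset.singleton_add]
          exact add_le_add (Multiset.singleton_le.2 hgx) hBy
      obtain ⟨y, hy, hBy⟩ := this
      obtain ⟨C, hC⟩ := Multiset.le_iff_exists_add.1 hBy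
      have hys : (y : Multiplicative (Multiset G)).toAdd.sum = 0 := y.2
      have hCs : C.sum = 0 := by rwa [hC, Multiset.sum_add, hB, zero_add] at hys
      let b : zeroSumSequences G := ⟨Multiplicative.ofAdd B, hB⟩
      let c : zeroSumSequences G := ⟨Multiplicative.ofAdd C, hCs⟩
      have hbc : y = b * c := Subtype.ext hC
      exact ⟨⟨b, hS y hy b ⟨c, hbc⟩⟩, rfl⟩
  · rintro ⟨G₀, hd⟩
    let S : Submonoid (zeroSumSequences G) :=
      { carrier := {x | ∀ g ∈ (x : Multiplicative (Multiset G)).toAdd, g ∈ G₀}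
        one_mem' := fun g hg => by simp at hg
        mul_mem' := by
          intro x y hx hy g hg
          rcases Multiset.mem_add.1 hg with hg | hg
          exacts [hx g hg, hy g hg] }
    refine ⟨S, ?_, ?_⟩
    · rintro a ha b ⟨c, rfl⟩ g hg
      exact ha g (Multiset.mem_add.2 (Or.inl hg))
    · refine (isLeast_distances_iff ((zeroSumSequences G).subtype.comp S.subtype) (hinj S) ?_).2 hd
      intro B
      constructor
      · rintro ⟨x, hx⟩
        have hx' : B = (x : zeroSumSequences G).1.toAdd := congrArg Multiplicative.toAdd hx.symm
        subst hx'
        exact ⟨x.1.2, x.2⟩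
      · rintro ⟨hB, hBm⟩
        exact ⟨⟨⟨Multiplicative.ofAdd B, hB⟩, hBm⟩, rfl⟩

end Translation

/-! ### Weights, index, and the lengths they control -/

section Weights

variable {G : Type*} [AddCommGroup G] {G₀ : Set G}

theorem HasLengthGap.mono {G₁ : Set G} {k : ℕ} (h : HasLengthGap G₀ k) (hs : G₀ ⊆ G₁) :
    HasLengthGap G₁ k := by
  obtain ⟨z, z', hz, hz', h1, h2⟩ := h
  exact ⟨z, z', hz.mono hs, hz'.mono hs, h1, h2⟩

theorem LengthsCongr.dvd_of_hasLengthGap {d k : ℕ} (h : LengthsCongr G₀ d)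
    (hk : HasLengthGap G₀ k) : d ∣ k := by
  obtain ⟨z, z', hz, hz', h1, h2⟩ := hk
  have := Int.modEq_iff_dvd.1 (h z z' hz hz' h1)
  rw [h2] at this
  push_cast at this
  rw [add_sub_cancel_left] at this
  exact_mod_cast this

theorem sum_eq_weight_nsmul {e : G} {w : G → ℕ} {A : Multiset G} (hw : ∀ g ∈ A, w g • e = g) :
    A.sum = (A.map w).sum • e := by
  induction A using Multiset.induction_on with
  | empty => simp
  | cons g A ih =>
    rw [Multiset.sum_cons, Multiset.map_cons, Multiset.sum_cons, add_smul,
      hw g (Multiset.mem_cons_self g A), ← ih fun k hk => hw k (Multiset.mem_cons_of_mem hk)]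

omit [AddCommGroup G] in
theorem eq_zero_of_weight_eq_zero {w : G → ℕ} {A : Multiset G} (hw : ∀ g ∈ A, 0 < w g)
    (h : (A.map w).sum = 0) : A = 0 := by
  by_contra hA
  obtain ⟨g, hg⟩ := Multiset.exists_mem_of_ne_zero hA
  have := Multiset.le_sum_of_mem (Multiset.mem_map_of_mem w hg)
  have := hw g hg
  omega

/-- Zero-sum sequences of index one are minimal. -/
theorem isMinZeroSum_of_weight {e : G} {w : G → ℕ} {A : Multiset G} (he : 0 < addOrderOf e)
    (hw : ∀ g ∈ A, 0 < w g ∧ w g • e = g) (hA : (A.map w).sum = addOrderOf e) :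
    IsMinZeroSum A := by
  refine ⟨?_, ?_, fun B hB hBs => ?_⟩
  · rintro rfl
    simp at hA; omega
  · rw [sum_eq_weight_nsmul fun g hg => (hw g hg).2, hA, addOrderOf_nsmul_eq_zero]
  · obtain ⟨C, rfl⟩ := Multiset.le_iff_exists_add.1 hB
    rw [sum_eq_weight_nsmul fun g hg => (hw g (Multiset.mem_of_le hB hg)).2,
      ← addOrderOf_dvd_iff_nsmul_eq_zero] at hBs
    rw [Multiset.map_add, Multiset.sum_add] at hA
    rcases Nat.eq_zero_or_pos (B.map w).sum with h | h
    · exact Or.inl (eq_zero_of_weight_eq_zero (fun g hg => (hw g (Multiset.mem_of_le hB hg)).1) h)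
    · right
      have := Nat.le_of_dvd h hBs
      have hC : C = 0 := eq_zero_of_weight_eq_zero
        (fun g hg => (hw g (Multiset.mem_add.2 (Or.inr hg))).1) (by omega)
      rw [hC, add_zero]

theorem isMinZeroSum_replicate_addOrderOf {e : G} (he : 0 < addOrderOf e) :
    IsMinZeroSum (replicate (addOrderOf e) e) := by
  refine isMinZeroSum_of_weight (e := e) (w := fun _ => 1) he ?_ (by simp)
  intro g hg
  rw [Multiset.eq_of_mem_replicate hg]
  simp

omit [AddCommGroup G] in
theorem weight_sum_eq {z : Multiset (Multiset G)} (w : G → ℕ) :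
    (z.sum.map w).sum = (z.map fun A => (A.map w).sum).sum := by
  induction z using Multiset.induction_on with
  | empty => simp
  | cons A z ih => simp [ih]

/-- Weight is additive, so the weight of a product fixes m times its length modulo md, and m
cancels. With discrete logarithms to base e as weights and m = ord e, the hypothesis says that every
index is 1 modulo d. -/
theorem lengthsCongr_of_weight (w : G → ℕ) {m d : ℕ} (hm : 0 < m)
    (h : ∀ A, IsMinZeroSum A → (∀ g ∈ A, g ∈ G₀) → (A.map w).sum ≡ m [MOD m * d]) :
    LengthsCongr G₀ d := by
  have key : ∀ z, IsFactorization G₀ z → (z.sum.map w).sum ≡ m * card z [MOD m * d] := by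
    intro z hz
    rw [weight_sum_eq]
    induction z using Multiset.induction_on with
    | empty => simp; rfl
    | cons A z ih =>
      have hA := hz A (Multiset.mem_cons_self A z)
      rw [Multiset.map_cons, Multiset.sum_cons, Multiset.card_cons, mul_add, mul_one, add_comm]
      exact (ih fun B hB => hz B (Multiset.mem_cons_of_mem hB)).add (h A hA.1 hA.2)
  intro z z' hz hz' hs
  have h1 := key z hz
  have h2 := key z' hz'
  rw [hs] at h1
  rw [Int.natCast_modEq_iff]
  exact Nat.ModEq.mul_left_cancel' hm.ne' (h1.symm.trans h2)

/-- A minimal zero-sum sequence of index `t` produces a length difference `t - 1`. -/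
theorem hasLengthGap_of_index {e : G} {w : G → ℕ} {A : Multiset G} {t : ℕ}
    (he : 0 < addOrderOf e) (heG : e ∈ G₀) (hA : IsMinZeroSum A) (hAG : ∀ g ∈ A, g ∈ G₀)
    (hw : ∀ g ∈ A, 0 < w g ∧ w g ≤ addOrderOf e ∧ w g • e = g)
    (ht : (A.map w).sum = addOrderOf e * t) : HasLengthGap G₀ (t - 1) := by
  set m := addOrderOf e with hm
  have hsum : ∀ B : Multiset G, (∀ g ∈ B, w g ≤ m) →
      (B.map fun g => g ::ₘ replicate (m - w g) e).sum = B + replicate (m * card B - (B.map w).sum) e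
        ∧ (B.map w).sum ≤ m * card B := by
    intro B
    induction B using Multiset.induction_on with
    | empty => simp
    | cons g B ih =>
      intro hB
      obtain ⟨ih1, ih2⟩ := ih fun k hk => hB k (Multiset.mem_cons_of_mem hk)
      have hg := hB g (Multiset.mem_cons_self g B)
      have e1 : m * (card B + 1) - (w g + (B.map w).sum)
          = (m - w g) + (m * card B - (B.map w).sum) := by
        rw [mul_add]; omega
      refine ⟨?_, ?_⟩
      · rw [Multiset.map_cons, Multiset.sum_cons, ih1, Multiset.map_cons, Multiset.sum_cons,
          Multiset.card_cons, e1, Multiset.replicate_add, Multiset.cons_add, Multiset.cons_add]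
        congr 1
        abel
      · rw [Multiset.map_cons, Multiset.sum_cons, Multiset.card_cons, mul_add]; omega
  obtain ⟨hs1, hs2⟩ := hsum A fun g hg => (hw g hg).2.1
  have htA : t ≤ card A := by
    rw [ht] at hs2
    exact Nat.le_of_mul_le_mul_left hs2 he
  have ht1 : 1 ≤ t := by
    rcases Nat.eq_zero_or_pos t with h | h
    · rw [h, mul_zero] at ht
      exact absurd (eq_zero_of_weight_eq_zero (fun g hg => (hw g hg).1) ht) hA.1
    · exact h
  have hU : ∀ g ∈ replicate m e, g ∈ G₀ := fun g hg => by
    rw [Multiset.eq_of_mem_replicate hg]; exact heG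
  -- With k = |A|: A · (e^m)^(k-t) is the product over the terms g of A of the index-one sequences g
  -- · e^(m - w g). The lengths are k - t + 1 and k.
  refine ⟨A ::ₘ replicate (card A - t) (replicate m e),
    A.map fun g => g ::ₘ replicate (m - w g) e, ?_, ?_, ?_, ?_⟩
  · exact (isFactorization_replicate _ (isMinZeroSum_replicate_addOrderOf he) hU).cons hA hAG
  · intro B hB
    obtain ⟨g, hg, rfl⟩ := Multiset.mem_map.1 hB
    obtain ⟨h1, h2, h3⟩ := hw g hg
    constructor
    · classical
      -- The index-one criterion needs weight 1 on e and `w g` on g. These could clash only for g =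
      -- e, where `w g` is shown to be 1 anyway.
      by_cases hge : g = e
      · subst hge
        have : w g ≡ 1 [MOD m] := by
          have h4 : w g • g = 1 • g := by rw [h3, one_smul]
          exact nsmul_eq_nsmul_iff_modEq.1 h4
        have h5 : g ::ₘ replicate (m - w g) g = replicate m g := by
          have hwg : w g = 1 := by
            rcases Nat.lt_or_ge 1 m with h | h
            · rcases Nat.lt_or_ge (w g) m with h' | h'
              · rw [Nat.ModEq, Nat.mod_eq_of_lt h', Nat.mod_eq_of_lt h] at this; exact this
              · have : w g = m := le_antisymm h2 h'
                rw [this, hm, addOrderOf_nsmul_eq_zero] at h3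
                rw [← h3] at hm
                simp at hm; omega
            · omega
          rw [hwg, ← Multiset.replicate_succ]
          congr 1; omega
        rw [h5]
        exact isMinZeroSum_replicate_addOrderOf he
      · refine isMinZeroSum_of_weight (e := e) (w := fun k => if k = e then 1 else w k) he ?_ ?_
        · intro k hk
          rcases Multiset.mem_cons.1 hk with rfl | hk
          · simp [hge, h1, h3]
          · rw [Multiset.eq_of_mem_replicate hk]; simp
        · simp [hge, ← hm]; omega
    · intro k hk
      rcases Multiset.mem_cons.1 hk with rfl | hk
      · exact hAG k hg
      · exact hU k (by rw [Multiset.eq_of_mem_replicate hk]; exact Multiset.mem_replicate.2 ⟨he.ne', rfl⟩)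
  · rw [hs1, Multiset.sum_cons, ht, Multiset.sum_replicate, Multiset.nsmul_replicate,
      mul_comm (card A - t), Nat.mul_sub]
  · simp; omega

end Weights

/-! ### Length differences over two elements -/

section TwoElements

variable {G : Type*} [AddCommGroup G]

/-- In a zero-sum subsequence the multiplicity of h is a multiple of j, so h^j acts as ag and
minimality becomes a statement about pairs (y, x). -/
theorem isMinZeroSum_replicate_add_replicate {g h : G} {j a y x : ℕ} (hj : 0 < j)
    (hmin : ∀ i : ℕ, i • h ∈ AddSubgroup.zmultiples g → j ∣ i) (hja : j • h = a • g)
    (hne : y ≠ 0 ∨ x ≠ 0) (hdvd : addOrderOf g ∣ y * a + x)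
    (hyx : ∀ y' ≤ y, ∀ x' ≤ x, addOrderOf g ∣ y' * a + x' →
      (y' = 0 ∧ x' = 0) ∨ (y' = y ∧ x' = x)) :
    IsMinZeroSum (replicate (j * y) h + replicate x g) := by
  classical
  have hs : ∀ y x : ℕ, (j * y) • h + x • g = (y * a + x) • g := by
    intro y x
    rw [mul_comm, mul_smul, hja, add_smul, mul_smul]
  refine ⟨?_, ?_, fun B hB hBs => ?_⟩
  · intro h0
    have := congrArg card h0
    simp at this
    omega
  · rw [Multiset.sum_add, Multiset.sum_replicate, Multiset.sum_replicate, hs]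
    exact addOrderOf_dvd_iff_nsmul_eq_zero.1 hdvd
  · obtain ⟨i, hi, hi'⟩ := Multiset.le_replicate_iff.1
      (Multiset.inter_le_right (s := B) (t := replicate (j * y) h))
    obtain ⟨x', hx, hx'⟩ := Multiset.le_replicate_iff.1
      (show B - replicate (j * y) h ≤ replicate x g by
        rw [tsub_le_iff_left]; exact hB)
    have hBe : B = replicate i h + replicate x' g := by
      rw [← hi', ← hx', add_comm, Multiset.sub_add_inter]
    rw [hBe, Multiset.sum_add, Multiset.sum_replicate, Multiset.sum_replicate] at hBs
    obtain ⟨y', rfl⟩ := hmin i (by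
      rw [eq_neg_of_add_eq_zero_left hBs]
      exact neg_mem (AddSubgroup.nsmul_mem_zmultiples g x'))
    rw [hs, ← addOrderOf_dvd_iff_nsmul_eq_zero] at hBs
    rcases hyx y' (Nat.le_of_mul_le_mul_left hi hj) x' hx hBs with ⟨rfl, rfl⟩ | ⟨rfl, rfl⟩
    · left; simpa using hBe
    · right; exact hBe

/-- The bounds say c = ⌈a/r⌉. Put W = h^(jq) g^r, V = h^(j(q-1)) g^(r+a) and T = h^(j(cq+1))
g^(cr-a). All are minimal and W^(c+1) = T · V, which gives lengths c + 1 and 2. -/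
theorem hasLengthGap_pair {g h : G} {j a q r c : ℕ} (hj : 0 < j)
    (hmin : ∀ i : ℕ, i • h ∈ AddSubgroup.zmultiples g → j ∣ i) (hja : j • h = a • g)
    (hm : addOrderOf g = q * a + r) (hq : 0 < q) (hra : r < a)
    (hc : a ≤ c * r) (hc' : c * r < a + r) : HasLengthGap {g, h} (c - 1) := by
  have hc1 : 1 ≤ c := by
    rcases Nat.eq_zero_or_pos c with rfl | h <;> omega
  have hmem : ∀ y x : ℕ, ∀ k ∈ replicate y h + replicate x g, k ∈ ({g, h} : Set G) := by
    intro y x k hk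
    rcases Multiset.mem_add.1 hk with hk | hk
    · right; exact Multiset.eq_of_mem_replicate hk
    · left; exact Multiset.eq_of_mem_replicate hk
  have small : ∀ y x : ℕ, y * a + x = q * a + r →
      IsMinZeroSum (replicate (j * y) h + replicate x g) := by
    intro y x hyx
    refine isMinZeroSum_replicate_add_replicate hj hmin hja ?_ (by rw [hm, hyx]) ?_
    · by_contra! h0
      rw [h0.1, h0.2] at hyx; omega
    · intro y' hy x' hx hd
      have h1 : y' * a ≤ y * a := Nat.mul_le_mul_right a hy
      rw [hm] at hd
      rcases Nat.eq_zero_or_pos (y' * a + x') with h0 | h0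
      · left
        have : y' * a = 0 := by omega
        rcases Nat.mul_eq_zero.1 this with h | h <;> omega
      · right
        have := Nat.le_of_dvd h0 hd
        have h2 : y' * a = y * a := by omega
        exact ⟨Nat.eq_of_mul_eq_mul_right (by omega) h2, by omega⟩
  have hT : IsMinZeroSum (replicate (j * (c * q + 1)) h + replicate (c * r - a) g) := by
    refine isMinZeroSum_replicate_add_replicate hj hmin hja (by omega) ⟨c, ?_⟩ ?_
    · rw [hm]; zify [hc]; ring
    · rintro y' hy x' hx ⟨t, ht⟩
      rw [hm] at ht
      rcases Nat.eq_zero_or_pos t with rfl | ht0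
      · left
        rw [mul_zero] at ht
        have : y' * a = 0 := by omega
        rcases Nat.mul_eq_zero.1 this with h | h <;> omega
      · right
        have h1 : r ≤ t * r := Nat.le_mul_of_pos_left r ht0
        -- Here x' ≤ cr - a < r, so tq blocks h^j fall short of t · ord g. One more block costs a,
        -- to be paid by the t remainders r; hence a ≤ tr, and t ≥ c by the choice of c.
        have h2 : t * q < y' := by
          by_contra! h2
          have h3 := Nat.mul_le_mul_right a h2
          have h4 : (q * a + r) * t = t * q * a + t * r := by ring
          omega
        obtain ⟨u, rfl⟩ := Nat.exists_eq_add_of_lt h2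
        have h3 : a * (u + 1) + x' = t * r := by nlinarith
        have h4 : c ≤ t := by
          by_contra! h4
          have : (t + 1) * r ≤ c * r := Nat.mul_le_mul_right r h4
          nlinarith
        have h5 : c * q ≤ t * q := Nat.mul_le_mul_right q h4
        have h6 : t * q = c * q := by omega
        have h7 : t = c := Nat.eq_of_mul_eq_mul_right hq h6
        have h8 : u = 0 := by omega
        subst h7 h8
        refine ⟨by omega, ?_⟩
        omega
  refine ⟨{replicate (j * (c * q + 1)) h + replicate (c * r - a) g,
      replicate (j * (q - 1)) h + replicate (r + a) g},
    replicate (c + 1) (replicate (j * q) h + replicate r g), ?_, ?_, ?_, ?_⟩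
  · intro A hA
    simp only [Multiset.insert_eq_cons, Multiset.mem_cons, Multiset.mem_singleton] at hA
    rcases hA with rfl | rfl
    · exact ⟨hT, hmem _ _⟩
    · refine ⟨small _ _ ?_, hmem _ _⟩
      obtain ⟨p, rfl⟩ := Nat.exists_eq_add_of_lt hq
      simp only [Nat.zero_add, Nat.add_sub_cancel]; ring
  · exact isFactorization_replicate _ (small _ _ rfl) (hmem _ _)
  · rw [Multiset.insert_eq_cons, Multiset.sum_cons, Multiset.sum_singleton, Multiset.sum_replicate,
      nsmul_add, Multiset.nsmul_replicate, Multiset.nsmul_replicate]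
    have e1 : (c + 1) * (j * q) = j * (c * q + 1) + j * (q - 1) := by
      obtain ⟨p, rfl⟩ := Nat.exists_eq_add_of_lt hq
      simp only [Nat.zero_add, Nat.add_sub_cancel]; ring
    have e2 : (c + 1) * r = (c * r - a) + (r + a) := by
      rw [add_mul]; omega
    rw [e1, e2, Multiset.replicate_add (j * (c * q + 1)), Multiset.replicate_add (c * r - a)]
    exact add_add_add_comm _ _ _ _
  · simp; omega

end TwoElements

/-! ### A bound for the number of divisors -/

section DivisorCount

theorem card_divisors_le_two_mul_card_filter (n : ℕ) :
    n.divisors.card ≤ 2 * ((Finset.Icc 1 n.sqrt).filter (· ∣ n)).card := by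
  classical
  rw [← Finset.card_filter_add_card_filter_not (s := n.divisors) (fun d => d ≤ n.sqrt), two_mul]
  apply add_le_add
  · apply Finset.card_le_card
    intro d hd
    simp only [Finset.mem_filter, Nat.mem_divisors, Finset.mem_Icc] at hd ⊢
    exact ⟨⟨Nat.pos_of_dvd_of_pos hd.1.1 (Nat.pos_of_ne_zero hd.1.2), hd.2⟩, hd.1.1⟩
  · apply Finset.card_le_card_of_injOn (fun d => n / d)
    · intro d hd
      simp only [Finset.coe_filter, Nat.mem_divisors, Set.mem_ofPred_eq, Finset.mem_Icc, not_le] at hd ⊢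
      obtain ⟨⟨⟨k, rfl⟩, h0⟩, hs⟩ := hd
      have hd0 : 0 < d := Nat.pos_of_ne_zero fun h => h0 (by simp [h])
      have hk0 : 0 < k := Nat.pos_of_ne_zero fun h => h0 (by simp [h])
      rw [Nat.mul_div_cancel_left k hd0]
      refine ⟨⟨hk0, ?_⟩, Dvd.intro_left d rfl⟩
      by_contra! hk
      have := Nat.lt_succ_sqrt (d * k)
      have := Nat.mul_le_mul hs hk
      simp only [Nat.succ_eq_add_one] at *
      omega
    · intro d hd d' hd' h
      simp only [Finset.coe_filter, Nat.mem_divisors, Set.mem_ofPred_eq] at hd hd' h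
      rw [← Nat.div_div_self hd.1.1 hd.1.2, ← Nat.div_div_self hd'.1.1 hd'.1.2, h]

/-- From 400 on, 2√n divisors at most and √n ≥ 20 suffice. Below 400 a computation finds at most 12
divisors up to √n, so at most 24 in all, and 240 ≤ 250. -/
theorem ten_mul_card_divisors_le {n : ℕ} (hn : 250 ≤ n) : 10 * n.divisors.card ≤ n := by
  have h := card_divisors_le_two_mul_card_filter n
  rcases Nat.lt_or_ge n 400 with hn' | hn'
  · have hs : n.sqrt ≤ 19 := by
      have : n.sqrt < 20 := Nat.sqrt_lt.2 (by omega)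
      omega
    have h1 : ((Finset.Icc 1 n.sqrt).filter (· ∣ n)).card ≤
        ((Finset.Icc 1 19).filter (· ∣ n)).card :=
      Finset.card_le_card (Finset.filter_subset_filter _ (Finset.Icc_subset_Icc le_rfl hs))
    have h2 : ∀ n ∈ Finset.Ico 250 400, ((Finset.Icc 1 19).filter (· ∣ n)).card ≤ 12 := by
      decide +kernel
    have := h2 n (Finset.mem_Ico.2 ⟨hn, hn'⟩)
    omega
  · have h1 : ((Finset.Icc 1 n.sqrt).filter (· ∣ n)).card ≤ n.sqrt := by
      simpa using Finset.card_filter_le (Finset.Icc 1 n.sqrt) (· ∣ n)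
    have h2 : 20 ≤ n.sqrt := Nat.le_sqrt.2 (by omega)
    have h3 := Nat.sqrt_le n
    have := Nat.mul_le_mul_right n.sqrt h2
    omega

end DivisorCount

/-! ### Subgroups and discrete logarithms in finite cyclic groups -/

section Cyclic

variable {G : Type*} [AddCommGroup G] [Finite G]

/-- A cyclic group has at most m solutions of my = 0, and for m = ord g the multiples of g already
supply m of them. -/
theorem mem_zmultiples_of_addOrderOf_dvd [IsAddCyclic G] {g x : G}
    (h : addOrderOf x ∣ addOrderOf g) : x ∈ AddSubgroup.zmultiples g := by
  classical
  cases nonempty_fintype G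
  rw [mem_zmultiples_iff_mem_range_addOrderOf]
  have : (Finset.range (addOrderOf g)).image (fun i => i • g) =
      Finset.univ.filter fun a : G => addOrderOf g • a = 0 := by
    apply Finset.eq_of_subset_of_card_le
    · intro y hy
      obtain ⟨i, -, rfl⟩ := Finset.mem_image.1 hy
      rw [Finset.mem_filter, smul_comm, addOrderOf_nsmul_eq_zero, smul_zero]
      exact ⟨Finset.mem_univ _, rfl⟩
    · rw [Finset.card_image_of_injOn, Finset.card_range]
      · exact IsAddCyclic.card_nsmul_eq_zero_le (addOrderOf_pos g)
      · intro i hi k hk hik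
        have := nsmul_eq_nsmul_iff_modEq.1 hik
        rwa [Nat.ModEq, Nat.mod_eq_of_lt (Finset.mem_range.1 hi),
          Nat.mod_eq_of_lt (Finset.mem_range.1 hk)] at this
  rw [this, Finset.mem_filter]
  exact ⟨Finset.mem_univ _, addOrderOf_dvd_iff_nsmul_eq_zero.1 h⟩

/-- The range is (0, ord e] rather than [0, ord e): the zero element gets weight ord e and all
weights stay positive. -/
theorem exists_nsmul_eq_of_mem_zmultiples {e x : G} (h : x ∈ AddSubgroup.zmultiples e) :
    ∃ a, 0 < a ∧ a ≤ addOrderOf e ∧ a • e = x := by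
  classical
  rw [mem_zmultiples_iff_mem_range_addOrderOf] at h
  obtain ⟨i, hi, rfl⟩ := Finset.mem_image.1 h
  have hi := Finset.mem_range.1 hi
  rcases Nat.eq_zero_or_pos i with rfl | h0
  · exact ⟨addOrderOf e, by omega, le_rfl, by simp [addOrderOf_nsmul_eq_zero]⟩
  · exact ⟨i, h0, hi.le, rfl⟩

omit [Finite G] in
theorem nsmul_inj_of_le_addOrderOf {e : G} {a b : ℕ} (ha : 0 < a) (ha' : a ≤ addOrderOf e)
    (hb : 0 < b) (hb' : b ≤ addOrderOf e) (h : a • e = b • e) : a = b := by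
  have h1 := (nsmul_eq_nsmul_iff_modEq.1 h)
  rcases le_total a b with hab | hab
  · have := (Nat.modEq_iff_dvd' hab).1 h1
    rcases Nat.eq_zero_or_pos (b - a) with h | h
    · omega
    · have := Nat.le_of_dvd h this; omega
  · have := (Nat.modEq_iff_dvd' hab).1 h1.symm
    rcases Nat.eq_zero_or_pos (a - b) with h | h
    · omega
    · have := Nat.le_of_dvd h this; omega

/-- Least positive discrete logarithms with respect to `e`. -/
theorem exists_discreteLog (e : G) : ∃ w : G → ℕ,
    (∀ g ∈ AddSubgroup.zmultiples e, 0 < w g ∧ w g ≤ addOrderOf e ∧ w g • e = g) ∧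
      ∀ a, 0 < a → a ≤ addOrderOf e → w (a • e) = a := by
  classical
  choose! w hw using fun (g : G) (hg : g ∈ AddSubgroup.zmultiples e) =>
    exists_nsmul_eq_of_mem_zmultiples hg
  refine ⟨w, hw, fun a ha ha' => ?_⟩
  obtain ⟨h1, h2, h3⟩ := hw (a • e) (AddSubgroup.nsmul_mem_zmultiples e a)
  exact nsmul_inj_of_le_addOrderOf h1 h2 ha ha' h3

/-- The least `j > 0` with `j • h ∈ ⟨g⟩` divides every such `j`. -/
theorem exists_index_nsmul (g h : G) : ∃ j a : ℕ, 0 < j ∧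
    (∀ i : ℕ, i • h ∈ AddSubgroup.zmultiples g → j ∣ i) ∧ j • h = a • g ∧ 0 < a ∧
      a ≤ addOrderOf g := by
  classical
  have hex : ∃ j : ℕ, 0 < j ∧ j • h ∈ AddSubgroup.zmultiples g :=
    ⟨addOrderOf h, addOrderOf_pos h, by rw [addOrderOf_nsmul_eq_zero]; exact zero_mem _⟩
  obtain ⟨h1, h2⟩ := Nat.find_spec hex
  obtain ⟨a, ha, ha', hae⟩ := exists_nsmul_eq_of_mem_zmultiples h2
  refine ⟨Nat.find hex, a, h1, fun i hi => ?_, hae.symm, ha, ha'⟩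
  by_contra hd
  have hr : 0 < i % Nat.find hex := Nat.pos_of_ne_zero fun h => hd (Nat.dvd_of_mod_eq_zero h)
  refine Nat.find_min hex (Nat.mod_lt i h1) ⟨hr, ?_⟩
  have h3 : i • h = (i % Nat.find hex) • h + (i / Nat.find hex) • (Nat.find hex • h) := by
    rw [← mul_smul, ← add_smul, mul_comm, Nat.mod_add_div]
  rw [← AddSubgroup.add_mem_cancel_right _ (AddSubgroup.nsmul_mem _ h2 (i / Nat.find hex)), ← h3]
  exact hi

end Cyclic

/-! ### Sets in which all relations are divisor relations -/

section DivisorPairs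

variable {G : Type*} [AddCommGroup G] [Finite G] [IsAddCyclic G]

/-- For all `g, h ∈ G₀` the relation `j • h = a • g` with `j` minimal and `0 < a ≤ ord g`
has `a ∣ ord g`. -/
def PairwiseDivisor {G : Type*} [AddCommGroup G] (G₀ : Set G) : Prop :=
  ∀ g ∈ G₀, ∀ h ∈ G₀, ∀ j a : ℕ, 0 < j → (∀ i : ℕ, i • h ∈ AddSubgroup.zmultiples g → j ∣ i) →
    j • h = a • g → 0 < a → a ≤ addOrderOf g → a ∣ addOrderOf g

variable {G₀ : Set G}

omit [Finite G] [IsAddCyclic G] in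
-- Both sides of jh = ag have a computable order, because j ∣ ord h and a ∣ ord g.
theorem addOrderOf_mul_eq_of_index {g h : G} {j a : ℕ} (hj : 0 < j)
    (hmin : ∀ i : ℕ, i • h ∈ AddSubgroup.zmultiples g → j ∣ i) (hja : j • h = a • g)
    (ha : 0 < a) (hdvd : a ∣ addOrderOf g) : addOrderOf h * a = addOrderOf g * j := by
  have hjd : j ∣ addOrderOf h := hmin _ (by rw [addOrderOf_nsmul_eq_zero]; exact zero_mem _)
  have h1 := addOrderOf_nsmul_of_dvd hj.ne' hjd
  have h2 := addOrderOf_nsmul_of_dvd ha.ne' hdvd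
  rw [hja, h2] at h1
  calc addOrderOf h * a = (addOrderOf h / j * j) * a := by rw [Nat.div_mul_cancel hjd]
    _ = (addOrderOf g / a * a) * j := by rw [← h1]; ring
    _ = addOrderOf g * j := by rw [Nat.div_mul_cancel hdvd]

theorem PairwiseDivisor.eq_of_addOrderOf_eq (hP : PairwiseDivisor G₀) {g h : G} (hg : g ∈ G₀)
    (hh : h ∈ G₀) (hgh : addOrderOf g = addOrderOf h) : g = h := by
  have hmem : h ∈ AddSubgroup.zmultiples g := mem_zmultiples_of_addOrderOf_dvd (by rw [hgh])
  obtain ⟨j, a, hj, hmin, hja, ha, ha'⟩ := exists_index_nsmul g h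
  have hj1 : j = 1 := Nat.dvd_one.1 (hmin 1 (by simpa using hmem))
  have hd := hP g hg h hh j a hj hmin hja ha ha'
  have := addOrderOf_mul_eq_of_index hj hmin hja ha hd
  rw [hgh, hj1] at this
  have ha1 : a = 1 := Nat.eq_of_mul_eq_mul_left (addOrderOf_pos h) this
  rw [hj1, ha1] at hja
  simpa using hja.symm

/-- The cross number of A is an integer, proved prime by prime. Let g in A have the largest p-part
of its order and let W be the p'-part of n. Then Wh = bg with b · ord h = W · ord g for each h in A,
so W · ΣA = 0 gives ord g ∣ Σb. Hence n divides W times the weight, and W is prime to p. -/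
theorem PairwiseDivisor.card_dvd_weight (hP : PairwiseDivisor G₀) {A : Multiset G}
    (hA : A.sum = 0) (hAG : ∀ g ∈ A, g ∈ G₀) :
    Nat.card G ∣ (A.map fun h => Nat.card G / addOrderOf h).sum := by
  classical
  set n := Nat.card G with hn
  have hn0 : n ≠ 0 := Nat.card_pos.ne'
  rcases Multiset.empty_or_exists_mem A with rfl | ⟨g₀, hg₀⟩
  · simp
  rw [Nat.dvd_iff_prime_pow_dvd_dvd]
  intro p k hp hpk
  obtain ⟨g, hg, hgmax⟩ := Finset.exists_max_image A.toFinset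
    (fun x => (addOrderOf x).factorization p) ⟨g₀, Multiset.mem_toFinset.2 hg₀⟩
  rw [Multiset.mem_toFinset] at hg
  set W := n / p ^ n.factorization p with hW
  have hrel : ∀ h ∈ A, ∃ b, W • h = b • g ∧ b * addOrderOf h = W * addOrderOf g := by
    intro h hh
    have hle := hgmax h (Multiset.mem_toFinset.2 hh)
    have hWmem : W • h ∈ AddSubgroup.zmultiples g := by
      apply mem_zmultiples_of_addOrderOf_dvd
      refine dvd_trans ?_ ((pow_dvd_pow p hle).trans (Nat.ordProj_dvd (addOrderOf g) p))
      rw [addOrderOf_dvd_iff_nsmul_eq_zero, ← mul_smul, ← addOrderOf_dvd_iff_nsmul_eq_zero]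
      have hdvd : addOrderOf h ∣ n := addOrderOf_dvd_natCard h
      conv_lhs => rw [← Nat.ordProj_mul_ordCompl_eq_self (addOrderOf h) p]
      exact mul_dvd_mul_left _ (Nat.ordCompl_dvd_ordCompl_of_dvd hdvd p)
    obtain ⟨j, a, hj, hmin, hja, ha, ha'⟩ := exists_index_nsmul g h
    obtain ⟨u, hu⟩ := hmin W hWmem
    have hd := hP g (hAG g hg) h (hAG h hh) j a hj hmin hja ha ha'
    have hm := addOrderOf_mul_eq_of_index hj hmin hja ha hd
    refine ⟨u * a, by rw [hu, mul_comm j u, mul_smul, hja, mul_smul], ?_⟩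
    rw [hu, mul_assoc, mul_comm a, hm]
    ring
  choose! b hb1 hb2 using hrel
  have hsum : ∀ B ≤ A, W • B.sum = (B.map b).sum • g ∧
      W * (B.map fun h => n / addOrderOf h).sum = (n / addOrderOf g) * (B.map b).sum := by
    intro B
    induction B using Multiset.induction_on with
    | empty => simp
    | cons h B ih =>
      intro hB
      obtain ⟨ih1, ih2⟩ := ih ((Multiset.le_cons_self B h).trans hB)
      have hh : h ∈ A := Multiset.mem_of_le hB (Multiset.mem_cons_self h B)
      simp only [Multiset.sum_cons, Multiset.map_cons, smul_add, add_smul, mul_add]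
      refine ⟨by rw [ih1, hb1 h hh], ?_⟩
      rw [ih2]
      congr 1
      apply Nat.eq_of_mul_eq_mul_right (addOrderOf_pos h)
      rw [mul_assoc, Nat.div_mul_cancel (addOrderOf_dvd_natCard h), mul_assoc, hb2 h hh,
        mul_left_comm, Nat.div_mul_cancel (addOrderOf_dvd_natCard g)]
  obtain ⟨h1, h2⟩ := hsum A le_rfl
  rw [hA, smul_zero] at h1
  have h3 : addOrderOf g ∣ (A.map b).sum := addOrderOf_dvd_iff_nsmul_eq_zero.2 h1.symm
  have h4 : n ∣ W * (A.map fun h => n / addOrderOf h).sum := by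
    rw [h2]
    calc n = n / addOrderOf g * addOrderOf g :=
          (Nat.div_mul_cancel (addOrderOf_dvd_natCard g)).symm
      _ ∣ _ := mul_dvd_mul_left _ h3
  exact ((Nat.coprime_ordCompl hp hn0).pow_left k).dvd_of_dvd_mul_left (hpk.trans h4)

omit [IsAddCyclic G] in
theorem IsMinZeroSum.count_le_addOrderOf [DecidableEq G] {A : Multiset G} (hA : IsMinZeroSum A)
    (g : G) : A.count g ≤ addOrderOf g := by
  by_contra! h
  rcases hA.2.2 (replicate (addOrderOf g) g) (Multiset.le_count_iff_replicate_le.1 h.le)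
    (by simp [addOrderOf_nsmul_eq_zero]) with h0 | h0
  · have := congrArg card h0
    rw [Multiset.card_replicate, Multiset.card_zero] at this
    exact (addOrderOf_pos g).ne' this
  · rw [← h0] at h
    simp at h

/-- In the pairwise divisor case, the cross numbers are integers and distances are small. -/
theorem PairwiseDivisor.lt_two_mul_card_divisors (hP : PairwiseDivisor G₀) {d : ℕ} (hd : 0 < d)
    (hc : LengthsCongr G₀ d) (hgap : HasLengthGap G₀ d) :
    d < 2 * (Nat.card G).divisors.card := by
  classical
  set n := Nat.card G with hn
  have hn0 : 0 < n := Nat.card_pos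
  set κ : Multiset G → ℕ := fun A => (A.map fun h => n / addOrderOf h).sum with hκ
  have hκadd : ∀ A B, κ (A + B) = κ A + κ B := fun A B => by simp [hκ]
  have hpos : ∀ h : G, 0 < n / addOrderOf h := fun h =>
    Nat.div_pos (Nat.le_of_dvd hn0 (addOrderOf_dvd_natCard h)) (addOrderOf_pos h)
  have hcount : ∀ A : Multiset G, κ A = ∑ g ∈ A.toFinset, A.count g * (n / addOrderOf g) :=
    fun A => by simp [hκ, Finset.sum_multiset_map_count]
  have hN : ∀ A : Multiset G, (∀ g ∈ A, g ∈ G₀) → A.toFinset.card ≤ n.divisors.card := by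
    intro A hA
    apply Finset.card_le_card_of_injOn addOrderOf
    · intro g _
      exact Nat.mem_divisors.2 ⟨addOrderOf_dvd_natCard g, hn0.ne'⟩
    · intro g hg h hh hgh
      exact hP.eq_of_addOrderOf_eq (hA g (by simpa using hg)) (hA h (by simpa using hh)) hgh
  have hκle : ∀ A, IsMinZeroSum A → κ A ≤ A.toFinset.card * n := by
    intro A hA
    rw [hcount, ← smul_eq_mul, ← Finset.sum_const]
    apply Finset.sum_le_sum
    intro g _
    calc _ ≤ addOrderOf g * (n / addOrderOf g) :=
          Nat.mul_le_mul_right _ (hA.count_le_addOrderOf g)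
      _ = n := Nat.mul_div_cancel' (addOrderOf_dvd_natCard g)
  set P : ℕ → Prop := fun K => ∃ A, IsMinZeroSum A ∧ (∀ g ∈ A, g ∈ G₀) ∧ κ A = n * K with hPdef
  have hPle : ∀ K, P K → K ≤ n.divisors.card := by
    rintro K ⟨A, hA, hAG, hK⟩
    have h1 := (hκle A hA).trans (Nat.mul_le_mul_right n (hN A hAG))
    rw [hK, mul_comm n K] at h1
    exact Nat.le_of_mul_le_mul_right h1 hn0
  have hPex : ∀ A, IsMinZeroSum A → (∀ g ∈ A, g ∈ G₀) → ∃ K, 0 < K ∧ κ A = n * K := by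
    intro A hA hAG
    obtain ⟨K, hK⟩ := hP.card_dvd_weight hA.2.1 hAG
    refine ⟨K, Nat.pos_of_ne_zero ?_, hK⟩
    rintro rfl
    rw [mul_zero] at hK
    exact hA.1 (eq_zero_of_weight_eq_zero (fun g _ => hpos g) hK)
  -- If every cross number were 1, it would determine the length, so all length differences would
  -- vanish: congruence modulo 0.
  have hbig : ∃ K, 2 ≤ K ∧ P K := by
    by_contra! hno
    have : LengthsCongr G₀ 0 := by
      apply lengthsCongr_of_weight (fun h => n / addOrderOf h) hn0
      intro A hA hAG
      obtain ⟨K, hK0, hK⟩ := hPex A hA hAG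
      have : K = 1 := by
        by_contra hK1
        exact hno K (by omega) ⟨A, hA, hAG, hK⟩
      rw [this, mul_one] at hK
      change κ A ≡ n [MOD n * 0]
      rw [hK]
    have := this.dvd_of_hasLengthGap hgap
    rw [zero_dvd_iff] at this
    omega
  obtain ⟨K₀, hK₀, hPK₀⟩ := hbig
  -- Maximality of K bounds lengths from below: an element of cross number x has no factorization
  -- shorter than x/K.
  set K := Nat.findGreatest P n.divisors.card with hKdef
  have hPK : P K := Nat.findGreatest_spec (hPle K₀ hPK₀) hPK₀
  have hKmax : ∀ k, P k → k ≤ K := fun k hk => Nat.le_findGreatest (hPle k hk) hk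
  have hK2 : 2 ≤ K := hK₀.trans (hKmax K₀ hPK₀)
  obtain ⟨A, hA, hAG, hAK⟩ := id hPK
  set N := A.toFinset.card with hNdef
  -- Some g contributes at least the average share K/N to the cross number of A.
  obtain ⟨g, hgA, hgK⟩ : ∃ g ∈ A.toFinset, n * K ≤ N * (A.count g * (n / addOrderOf g)) := by
    by_contra! hno
    have hne : A.toFinset.Nonempty := by
      rw [Multiset.toFinset_nonempty]; exact hA.1
    have h1 := Finset.sum_lt_sum_of_nonempty hne hno
    rw [← Finset.mul_sum, ← hcount, hAK, Finset.sum_const, smul_eq_mul] at h1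
    exact lt_irrefl _ h1
  rw [Multiset.mem_toFinset] at hgA
  set v := A.count g with hv
  set o := addOrderOf g with ho
  have ho0 : 0 < o := addOrderOf_pos g
  have hv0 : 0 < v := Multiset.count_pos.2 hgA
  have hon : o * (n / o) = n := Nat.mul_div_cancel' (addOrderOf_dvd_natCard g)
  have hvN : o * K ≤ N * v := by
    apply Nat.le_of_mul_le_mul_right _ (hpos g)
    calc o * K * (n / o) = n * K := by rw [mul_right_comm, hon]
      _ ≤ N * v * (n / o) := by rw [mul_assoc]; exact hgK
  -- `y + 1 = ⌈o / v⌉`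
  set y := (o - 1) / v with hy
  have hy1 : y * v < o := by
    have : y * v ≤ o - 1 := Nat.div_mul_le_self (o - 1) v
    omega
  have hy2 : o ≤ (y + 1) * v := by
    have : o - 1 < y * v + v := Nat.lt_div_mul_add hv0
    rw [add_mul, one_mul]; omega
  have hyN : y * K < N := by
    have h1 : o * (y * K) < o * N := by
      calc o * (y * K) = y * (o * K) := by ring
        _ ≤ y * (N * v) := Nat.mul_le_mul_left y hvN
        _ = (y * v) * N := by ring
        _ < o * N := Nat.mul_lt_mul_of_pos_right hy1
          (Finset.card_pos.2 (Multiset.toFinset_nonempty.2 hA.1))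
    exact Nat.lt_of_mul_lt_mul_left h1
  -- Split A^(y+1) = g^o · C and factor C into z. The difference |z| - y is positive and |z| ≤
  -- (y+1)K - 1 < N + K, where N and K are each at most the number of divisors of n.
  have hle : replicate o g ≤ (y + 1) • A := by
    rw [← Multiset.le_count_iff_replicate_le, Multiset.count_nsmul]
    exact hy2
  obtain ⟨C, hC⟩ := Multiset.le_iff_exists_add.1 hle
  have hCs : C.sum = 0 := by
    have := congrArg Multiset.sum hC
    rwa [Multiset.sum_nsmul, hA.2.1, smul_zero, Multiset.sum_add, Multiset.sum_replicate,
      addOrderOf_nsmul_eq_zero, zero_add, eq_comm] at this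
  obtain ⟨z, hz, hzC⟩ := exists_factorization (G₀ := G₀) C hCs fun x hx =>
    hAG x (Multiset.mem_of_mem_nsmul (n := y + 1) (by rw [hC]; exact Multiset.mem_add.2 (Or.inr hx)))
  have hgG : ∀ x ∈ replicate o g, x ∈ G₀ := fun x hx => by
    rw [Multiset.eq_of_mem_replicate hx]; exact hAG g hgA
  have hκz : ∀ z : Multiset (Multiset G), IsFactorization G₀ z →
      n * card z ≤ κ z.sum ∧ κ z.sum ≤ n * K * card z := by
    intro z hz
    induction z using Multiset.induction_on with
    | empty => simp [hκ]
    | cons B z ih =>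
      have ih := ih fun D hD => hz D (Multiset.mem_cons_of_mem hD)
      have hB := hz B (Multiset.mem_cons_self B z)
      obtain ⟨k, hk0, hk⟩ := hPex B hB.1 hB.2
      have hkK := hKmax k ⟨B, hB.1, hB.2, hk⟩
      rw [Multiset.sum_cons, hκadd, Multiset.card_cons, hk, mul_add, mul_add, mul_one, mul_one]
      have h1 := Nat.mul_le_mul_left n hkK
      have h2 := Nat.mul_le_mul_left n (show 1 ≤ k from hk0)
      constructor <;> omega
  have hκC : n * ((y + 1) * K) = n + κ C := by
    have := congrArg κ hC
    have e1 : ∀ t : ℕ, κ (t • A) = t * κ A := by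
      intro t; simp [hκ, Multiset.map_nsmul, Multiset.sum_nsmul]
    rw [hκadd, e1, hAK] at this
    have e2 : κ (replicate o g) = n := by simp [hκ, hon, ← ho]
    rw [e2] at this
    rw [← this]; ring
  obtain ⟨hz1, hz2⟩ := hκz z hz
  rw [hzC] at hz1 hz2
  have hz3 : card z + 1 ≤ (y + 1) * K := by
    apply Nat.le_of_mul_le_mul_left _ hn0
    rw [hκC, mul_add]; omega
  have hz4 : (y + 1) * K ≤ 1 + K * card z := by
    apply Nat.le_of_mul_le_mul_left _ hn0
    rw [hκC, mul_add, ← mul_assoc]; omega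
  have hz5 : y + 1 ≤ card z := by
    by_contra! h
    have := Nat.mul_le_mul_left K (show card z ≤ y by omega)
    have e : (y + 1) * K = K * y + K := by ring
    omega
  have hgap2 : HasLengthGap G₀ (card z - y) := by
    refine ⟨replicate (y + 1) A, replicate o g ::ₘ z, isFactorization_replicate _ hA hAG,
      hz.cons (isMinZeroSum_replicate_addOrderOf ho0) hgG, ?_, ?_⟩
    · rw [Multiset.sum_replicate, Multiset.sum_cons, hzC, hC]
    · simp; omega
  have hdle := Nat.le_of_dvd (by omega) (hc.dvd_of_hasLengthGap hgap2)
  have hdz := hdle.trans (Nat.sub_le _ _)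
  have hKN := hPle K hPK
  have hNN := hN A hAG
  have e : (y + 1) * K = y * K + K := by ring
  omega

end DivisorPairs

/-! ### The two families that realise the values -/

section Families

variable {G : Type*} [AddCommGroup G] [Finite G] {G₀ : Set G}

omit [AddCommGroup G] [Finite G] in
theorem exists_eq_replicate_add_replicate {a b : G} {A : Multiset G}
    (hA : ∀ g ∈ A, g = a ∨ g = b) : ∃ x y, A = replicate x a + replicate y b := by
  induction A using Multiset.induction_on with
  | empty => exact ⟨0, 0, by simp⟩
  | cons g A ih =>
    obtain ⟨x, y, rfl⟩ := ih fun k hk => hA k (Multiset.mem_cons_of_mem hk)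
    rcases hA g (Multiset.mem_cons_self _ _) with rfl | rfl
    · exact ⟨x + 1, y, by simp [Multiset.replicate_succ]⟩
    · exact ⟨x, y + 1, by simp [Multiset.replicate_succ]⟩

omit [AddCommGroup G] [Finite G] in
theorem exists_eq_replicate_add_replicate_add_replicate {a b c : G} {A : Multiset G}
    (hA : ∀ g ∈ A, g = a ∨ g = b ∨ g = c) :
    ∃ x y v, A = replicate x a + replicate y b + replicate v c := by
  induction A using Multiset.induction_on with
  | empty => exact ⟨0, 0, 0, by simp⟩
  | cons g A ih =>
    obtain ⟨x, y, v, rfl⟩ := ih fun k hk => hA k (Multiset.mem_cons_of_mem hk)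
    rcases hA g (Multiset.mem_cons_self _ _) with rfl | rfl | rfl
    · exact ⟨x + 1, y, v, by simp [Multiset.replicate_succ]⟩
    · exact ⟨x, y + 1, v, by simp [Multiset.replicate_succ]⟩
    · exact ⟨x, y, v + 1, by simp [Multiset.replicate_succ]⟩

omit [Finite G] in
theorem IsMinZeroSum.eq_of_le {A B : Multiset G} (hA : IsMinZeroSum A) (hB : B ≤ A)
    (hBs : B.sum = 0) (hB0 : 0 < card B) : A = B := by
  rcases hA.2.2 B hB hBs with rfl | rfl
  · simp at hB0
  · rfl

omit [Finite G] in
theorem IsMinZeroSum.eq_singleton_zero {A : Multiset G} (hA : IsMinZeroSum A)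
    (h0 : (0 : G) ∈ A) : A = {0} :=
  hA.eq_of_le (Multiset.singleton_le.2 h0) (by simp) (by simp)

/-- Lengths over `{0, f, m • f}` are congruent modulo `m - 1` when `ord f ≡ 1 mod m`. -/
theorem lengthsCongr_generator_nsmul {f : G} {m c : ℕ} (hm : 2 ≤ m) (hc : 0 < c)
    (hf : addOrderOf f = c * m + 1) (hG : ∀ g ∈ G₀, g = 0 ∨ g = f ∨ g = m • f) :
    LengthsCongr G₀ (m - 1) := by
  obtain ⟨w, -, hw⟩ := exists_discreteLog f
  set h := addOrderOf f with hh
  have hmh : m < h := by nlinarith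
  have hw0 : w 0 = h := by
    have := hw h (by omega) le_rfl
    rwa [addOrderOf_nsmul_eq_zero] at this
  have hw1 : w f = 1 := by simpa using hw 1 (by omega) (by omega)
  have hwm : w (m • f) = m := hw m (by omega) hmh.le
  have zero_iff : ∀ y x : ℕ, (replicate y f + replicate x (m • f)).sum = 0 ↔ h ∣ y + x * m := by
    intro y x
    rw [hh, addOrderOf_dvd_iff_nsmul_eq_zero]
    simp only [Multiset.sum_add, Multiset.sum_replicate, ← mul_smul, ← add_smul]
  apply lengthsCongr_of_weight w (m := h) (by omega)
  intro A hA hAG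
  by_cases h0 : (0 : G) ∈ A
  · rw [hA.eq_singleton_zero h0, Multiset.map_singleton, Multiset.sum_singleton, hw0]
  obtain ⟨y, x, rfl⟩ := exists_eq_replicate_add_replicate (a := f) (b := m • f) (A := A) (by
    intro g hg
    rcases hG g (hAG g hg) with rfl | h | h
    exacts [absurd hg h0, Or.inl h, Or.inr h])
  have hwt : ∀ y x : ℕ, ((replicate y f + replicate x (m • f)).map w).sum = y + x * m := by
    intro y x
    simp [hw1, hwm]
  have hdvd := (zero_iff y x).1 hA.2.1
  have hpos : 0 < y + x := by
    have := Multiset.card_pos.2 hA.1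
    simpa using this
  have hsub : ∀ y' x' : ℕ, y' ≤ y → x' ≤ x → 0 < y' + x' → h ∣ y' + x' * m →
      ((replicate y f + replicate x (m • f)).map w).sum = y' + x' * m := by
    intro y' x' hy hx h1 h2
    rw [hA.eq_of_le (B := replicate y' f + replicate x' (m • f))
      (add_le_add (Multiset.replicate_le_replicate _ |>.2 hy)
        (Multiset.replicate_le_replicate _ |>.2 hx)) ((zero_iff _ _).2 h2) (by simpa using h1), hwt]
  -- Without f, only (mf)^h is possible, of index m. With f present, either x < c and the index is
  -- 1, or f · (mf)^c is already zero-sum, again of index 1.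
  rcases Nat.eq_zero_or_pos y with rfl | hy
  · have hx : h ∣ x := by
      rw [zero_add] at hdvd
      refine Nat.Coprime.dvd_of_dvd_mul_right ?_ hdvd
      rw [hf]
      simp
    rw [hsub 0 h le_rfl (Nat.le_of_dvd (by omega) hx) (by omega) (by simp)]
    rw [Nat.ModEq.comm, Nat.modEq_iff_dvd' (by nlinarith)]
    exact ⟨1, by rw [Nat.mul_sub]; simp⟩
  · rcases Nat.lt_or_ge x c with hx | hx
    · have h1 : x * m < h := by
        have := Nat.mul_le_mul_right m hx.le
        omega
      have h2 := Nat.le_of_dvd (by omega) hdvd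
      rw [hsub (h - x * m) x (by omega) le_rfl (by omega) (by rw [Nat.sub_add_cancel h1.le]),
        Nat.sub_add_cancel h1.le]
    · rw [hsub 1 c hy hx (by omega) (by rw [hf, add_comm]), hf, add_comm]

/-- Lengths over `{0, e, -e, u • e}` are congruent modulo `u - 1` when `ord e = 2 u`. -/
theorem lengthsCongr_neg_half {e : G} {u : ℕ} (hu : 2 ≤ u) (he : addOrderOf e = 2 * u)
    (hG : ∀ g ∈ G₀, g = 0 ∨ g = e ∨ g = -e ∨ g = u • e) : LengthsCongr G₀ (u - 1) := by
  obtain ⟨w, -, hw⟩ := exists_discreteLog e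
  have h2u : (2 * u) • e = 0 := by rw [← he, addOrderOf_nsmul_eq_zero]
  have hneg : (2 * u - 1) • e = -e := by
    rw [eq_neg_iff_add_eq_zero, ← succ_nsmul, Nat.sub_add_cancel (by omega), h2u]
  have hw0 : w 0 = 2 * u := by
    have := hw (2 * u) (by omega) (by omega)
    rwa [h2u] at this
  have hw1 : w e = 1 := by simpa using hw 1 (by omega) (by omega)
  have hwn : w (-e) = 2 * u - 1 := by
    rw [← hneg]; exact hw _ (by omega) (by omega)
  have hwu : w (u • e) = u := hw u (by omega) (by omega)
  apply lengthsCongr_of_weight w (m := 2 * u) (by omega)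
  intro A hA hAG
  by_cases h0 : (0 : G) ∈ A
  · rw [hA.eq_singleton_zero h0, Multiset.map_singleton, Multiset.sum_singleton, hw0]
  obtain ⟨x, y, v, rfl⟩ := exists_eq_replicate_add_replicate_add_replicate
    (a := e) (b := -e) (c := u • e) (A := A) (by
      intro g hg
      rcases hG g (hAG g hg) with rfl | h | h
      exacts [absurd hg h0, Or.inl h, Or.inr h])
  have zero_iff : ∀ x y v : ℕ,
      (replicate x e + replicate y (-e) + replicate v (u • e)).sum = 0 ↔
        y ≡ x + v * u [MOD 2 * u] := by
    intro x y v
    rw [← he, ← nsmul_eq_nsmul_iff_modEq]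
    simp only [Multiset.sum_add, Multiset.sum_replicate, add_smul, mul_smul, smul_neg]
    constructor
    · intro h
      rw [eq_comm, ← sub_eq_zero, ← h]; abel
    · intro h
      rw [h]; abel
  have hwt : ∀ x y v : ℕ, ((replicate x e + replicate y (-e) + replicate v (u • e)).map w).sum
      = x + y * (2 * u - 1) + v * u := by
    intro x y v
    simp [hw1, hwn, hwu]
  have hsub : ∀ x' y' v' : ℕ, x' ≤ x → y' ≤ y → v' ≤ v → 0 < x' + y' + v' →
      y' ≡ x' + v' * u [MOD 2 * u] →
      ((replicate x e + replicate y (-e) + replicate v (u • e)).map w).sum =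
        x' + y' * (2 * u - 1) + v' * u := by
    intro x' y' v' hx hy hv h1 h2
    rw [hA.eq_of_le (B := replicate x' e + replicate y' (-e) + replicate v' (u • e))
      (add_le_add (add_le_add (Multiset.replicate_le_replicate _ |>.2 hx)
        (Multiset.replicate_le_replicate _ |>.2 hy)) (Multiset.replicate_le_replicate _ |>.2 hv))
      ((zero_iff _ _ _).2 h2) (by simpa using h1), hwt]
  have hpos : 0 < x + y + v := by
    have := Multiset.card_pos.2 hA.1
    simpa [add_assoc] using this
  have hmod := (zero_iff x y v).1 hA.2.1
  obtain ⟨t, rfl⟩ : ∃ t, u = t + 2 := ⟨u - 2, by omega⟩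
  have e1 : 2 * (t + 2) - 1 = 2 * t + 3 := by omega
  have e2 : t + 2 - 1 = t + 1 := by omega
  rw [e1] at hsub
  rw [e2]
  -- The nonzero possibilities are e(-e), (ue)², e^(2u), e^u(ue), all of index 1, and (-e)^(2u),
  -- (-e)^u(ue), of indices 2u - 1 and u. All are 1 modulo u - 1.
  by_cases hxy : 0 < x ∧ 0 < y
  · rw [hsub 1 1 0 hxy.1 hxy.2 (Nat.zero_le _) (by omega) (by simp; rfl)]
    have : 1 + 1 * (2 * t + 3) + 0 * (t + 2) = 2 * (t + 2) := by ring
    rw [this]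
  by_cases hv : 2 ≤ v
  · rw [hsub 0 0 2 (Nat.zero_le _) (Nat.zero_le _) hv (by omega) (by
      rw [zero_add]; exact (Nat.modEq_zero_iff_dvd.2 dvd_rfl).symm)]
    have : 0 + 0 * (2 * t + 3) + 2 * (t + 2) = 2 * (t + 2) := by ring
    rw [this]
  rcases (by omega : v = 0 ∨ v = 1) with rfl | rfl
  · rw [zero_mul, add_zero] at hmod
    rcases Nat.eq_zero_or_pos x with rfl | hx
    · have h1 := Nat.le_of_dvd (by omega) (Nat.modEq_zero_iff_dvd.1 hmod)
      rw [hsub 0 (2 * (t + 2)) 0 le_rfl h1 le_rfl (by omega) (by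
        simp only [zero_mul, add_zero]; exact Nat.modEq_zero_iff_dvd.2 dvd_rfl)]
      rw [Nat.ModEq.comm, Nat.modEq_iff_dvd' (by nlinarith)]
      refine ⟨2, ?_⟩
      rw [Nat.sub_eq_iff_eq_add (by nlinarith)]
      ring
    · obtain rfl : y = 0 := by omega
      have h1 := Nat.le_of_dvd (by omega) (Nat.modEq_zero_iff_dvd.1 hmod.symm)
      rw [hsub (2 * (t + 2)) 0 0 h1 le_rfl le_rfl (by omega) (by
        simp only [zero_mul, add_zero]; exact (Nat.modEq_zero_iff_dvd.2 dvd_rfl).symm)]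
      simp; rfl
  · rw [one_mul] at hmod
    rcases Nat.eq_zero_or_pos x with rfl | hx
    · have h1 : t + 2 ≤ y := by
        have h2 := hmod.symm
        rw [Nat.ModEq, zero_add, Nat.mod_eq_of_lt (by omega)] at h2
        rw [h2]; exact Nat.mod_le _ _
      rw [hsub 0 (t + 2) 1 le_rfl h1 le_rfl (by omega) (by rw [one_mul, zero_add])]
      rw [Nat.ModEq.comm, Nat.modEq_iff_dvd' (by nlinarith)]
      refine ⟨1, ?_⟩
      rw [Nat.sub_eq_iff_eq_add (by nlinarith)]
      ring
    · obtain rfl : y = 0 := by omega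
      have h1 : t + 2 ≤ x := by
        have h2 := Nat.le_of_dvd (by omega) (Nat.modEq_zero_iff_dvd.1 hmod.symm)
        omega
      rw [hsub (t + 2) 0 1 h1 le_rfl le_rfl (by omega) (by
        rw [one_mul, ← two_mul]; exact (Nat.modEq_zero_iff_dvd.2 dvd_rfl).symm)]
      have : t + 2 + 0 * (2 * t + 3) + 1 * (t + 2) = 2 * (t + 2) := by ring
      rw [this]

/-- Since m is prime to ord f, the sequence (mf)^(ord f) is minimal; its index m with respect to f
realises the difference m - 1. -/
theorem sub_one_mem_groupMinDistances_of_modEq_one {f : G} {m c : ℕ} (hm : 2 ≤ m) (hc : 0 < c)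
    (hf : addOrderOf f = c * m + 1) : m - 1 ∈ groupMinDistances G := by
  rw [mem_groupMinDistances_iff]
  refine ⟨{f, m • f}, by omega, lengthsCongr_generator_nsmul hm hc hf fun g hg => Or.inr hg, ?_⟩
  have hord : addOrderOf (m • f) = addOrderOf f := by
    apply Nat.Coprime.addOrderOf_nsmul
    rw [hf]
    simp
  have hpos := addOrderOf_pos f
  refine hasLengthGap_of_index (e := f) (w := fun _ => m)
    (A := replicate (addOrderOf (m • f)) (m • f)) hpos (Or.inl rfl)
    (isMinZeroSum_replicate_addOrderOf (by rw [hord]; exact hpos)) ?_ ?_ ?_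
  · intro g hg
    exact Or.inr (Multiset.eq_of_mem_replicate hg)
  · intro g hg
    rw [Multiset.eq_of_mem_replicate hg]
    exact ⟨by omega, by nlinarith, rfl⟩
  · simp [hord]

/-- Because ue = u(-e), the sequence (ue)(-e)^u has index 1 with respect to -e, hence is minimal,
but index u with respect to e. -/
theorem sub_one_mem_groupMinDistances_of_even {e : G} {u : ℕ} (hu : 2 ≤ u)
    (he : addOrderOf e = 2 * u) : u - 1 ∈ groupMinDistances G := by
  classical
  rw [mem_groupMinDistances_iff]
  refine ⟨{e, -e, u • e}, by omega, lengthsCongr_neg_half hu he fun g hg => Or.inr hg, ?_⟩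
  have h2u : (2 * u) • e = 0 := by rw [← he, addOrderOf_nsmul_eq_zero]
  have hneg : (2 * u - 1) • e = -e := by
    rw [eq_neg_iff_add_eq_zero, ← succ_nsmul, Nat.sub_add_cancel (by omega), h2u]
  have huneg : u • (-e) = u • e := by
    rw [smul_neg, neg_eq_iff_add_eq_zero, ← add_smul, ← two_mul, h2u]
  have hne : u • e ≠ -e := by
    rw [← hneg]
    intro h
    have := nsmul_inj_of_le_addOrderOf (by omega) (by omega) (by omega) (by omega) h
    omega
  have hA : ∀ g ∈ u • e ::ₘ replicate u (-e), g = u • e ∨ g = -e := by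
    intro g hg
    rcases Multiset.mem_cons.1 hg with h | h
    exacts [Or.inl h, Or.inr (Multiset.eq_of_mem_replicate h)]
  refine hasLengthGap_of_index (e := e) (w := fun g => if g = -e then 2 * u - 1 else u)
    (A := u • e ::ₘ replicate u (-e)) (by omega) (Or.inl rfl) ?_ ?_ ?_ ?_
  · refine isMinZeroSum_of_weight (e := -e) (w := fun g => if g = -e then 1 else u)
      (by rw [addOrderOf_neg]; omega) ?_ ?_
    · intro g hg
      rcases hA g hg with rfl | rfl
      · simp only [hne, if_false]
        exact ⟨by omega, huneg⟩
      · simp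
    · simp [hne, he]; omega
  · intro g hg
    rcases hA g hg with rfl | rfl <;> simp
  · intro g hg
    rcases hA g hg with rfl | rfl
    · simp only [hne, if_false]
      exact ⟨by omega, by omega, trivial⟩
    · simp only [if_true]
      exact ⟨by omega, by omega, hneg⟩
  · simp only [Multiset.map_cons, Multiset.map_replicate, Multiset.sum_cons,
      Multiset.sum_replicate, hne, if_false, if_true, he, smul_eq_mul]
    zify [show 1 ≤ 2 * u by omega]
    ring

end Families

/-! ### Arithmetic of the large values -/

/-- The values `d ≥ n / 5` that occur as minimal distances for a cyclic group of order `n`. -/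
def IsLargeMinDistance (n d : ℕ) : Prop :=
  d + 2 = n ∨ 2 * d + 2 = n ∨ 2 * d + 3 = n ∨ 2 * d + 4 = n ∨ 3 * d + 4 = n ∨ 3 * d + 6 = n ∨
    4 * d + 4 = n ∨ 4 * d + 5 = n ∨ 4 * d + 6 = n ∨ 4 * d + 8 = n

/-- The pairs `{e, a • e}` with `ord e = n` that do not settle the value of `d` by themselves. -/
def IsExceptionalPair (n d a : ℕ) : Prop :=
  (a + 1 = n ∧ (3 * d + 2 = n ∨ 4 * d + 2 = n)) ∨ (a + 2 = n ∧ 4 * d + 3 = n) ∨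
    (2 * a + 1 = n ∧ 4 * d + 3 = n) ∨ (a + 3 = n ∧ 3 * d + 5 = n) ∨ (a + 4 = n ∧ 4 * d + 7 = n)

/-- From (c-1)r < a follows dkr < a, so d · sqkr < n ≤ 5d and sqkr ≤ 4. With i = cr - a < r also
bounded, a and n are explicit linear functions of d in each of finitely many cases. -/
theorem isLargeMinDistance_or_isExceptionalPair {n s q r k a c d : ℕ} (hn : 250 ≤ n)
    (hnd : n ≤ 5 * d) (hns : n = s * (q * a + r)) (hq : 0 < q) (hr : 0 < r) (hra : r < a)
    (hc : a ≤ c * r) (hc' : c * r < a + r) (hk : c - 1 = d * k) :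
    IsLargeMinDistance n d ∨ s = 1 ∧ IsExceptionalPair n d a := by
  have hs : 0 < s := Nat.pos_of_ne_zero (by rintro rfl; omega)
  have hd : 0 < d := by omega
  have hc2 : 2 ≤ c := by
    by_contra! h
    have := Nat.mul_le_mul_right r (show c ≤ 1 by omega)
    omega
  have hk0 : 0 < k := Nat.pos_of_ne_zero (by rintro rfl; omega)
  have hcr : d * k * r < a := by
    rw [← hk, Nat.sub_mul]; omega
  have hprod : s * q * k * r < 5 := by
    have h1 : q * (d * k * r) ≤ q * a := Nat.mul_le_mul_left q hcr.le
    have h2 : s * (q * (d * k * r)) < n := by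
      rw [hns]; exact Nat.mul_lt_mul_of_pos_left (by omega) hs
    have h3 : d * (s * q * k * r) < d * 5 := by
      calc d * (s * q * k * r) = s * (q * (d * k * r)) := by ring
        _ < n := h2
        _ ≤ d * 5 := by omega
    exact Nat.lt_of_mul_lt_mul_left h3
  have hqk : 0 < q * k := Nat.mul_pos hq hk0
  have hsle : s < 5 := lt_of_le_of_lt (Nat.le_of_dvd (by positivity) ⟨q * k * r, by ring⟩) hprod
  have hqle : q < 5 := lt_of_le_of_lt (Nat.le_of_dvd (by positivity) ⟨s * k * r, by ring⟩) hprod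
  have hkle : k < 5 := lt_of_le_of_lt (Nat.le_of_dvd (by positivity) ⟨s * q * r, by ring⟩) hprod
  have hrle : r < 5 := lt_of_le_of_lt (Nat.le_of_dvd (by positivity) ⟨s * q * k, by ring⟩) hprod
  have hsq : s * q < 5 := lt_of_le_of_lt (Nat.le_of_dvd (by positivity) ⟨k * r, by ring⟩) hprod
  obtain ⟨i, hi⟩ : ∃ i, c * r = a + i := ⟨c * r - a, by omega⟩
  have hir : i < r := by omega
  rw [mul_assoc] at hprod
  unfold IsLargeMinDistance IsExceptionalPair
  clear hcr hqk hnd hd hc hc'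
  interval_cases s <;> interval_cases q <;> first | (exfalso; clear * - hsq; omega) | skip
  all_goals
    clear hsq
    interval_cases k <;> interval_cases r <;> first | (exfalso; clear * - hprod; omega) | skip
  all_goals
    interval_cases i
  all_goals first
    | exact Or.inl (Or.inl (by omega))
    | exact Or.inl (Or.inr (Or.inl (by omega)))
    | exact Or.inl (Or.inr (Or.inr (Or.inl (by omega))))
    | exact Or.inl (Or.inr (Or.inr (Or.inr (Or.inl (by omega)))))
    | exact Or.inl (Or.inr (Or.inr (Or.inr (Or.inr (Or.inl (by omega))))))
    | exact Or.inl (Or.inr (Or.inr (Or.inr (Or.inr (Or.inr (Or.inl (by omega)))))))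
    | exact Or.inl (Or.inr (Or.inr (Or.inr (Or.inr (Or.inr (Or.inr (Or.inl (by omega))))))))
    | exact Or.inl (Or.inr (Or.inr (Or.inr (Or.inr (Or.inr (Or.inr (Or.inr (Or.inl (by omega)))))))))
    | exact Or.inl (Or.inr (Or.inr (Or.inr (Or.inr (Or.inr (Or.inr (Or.inr (Or.inr
        (Or.inl (by omega))))))))))
    | exact Or.inl (Or.inr (Or.inr (Or.inr (Or.inr (Or.inr (Or.inr (Or.inr (Or.inr
        (Or.inr (by omega))))))))))
    | exact Or.inr ⟨rfl, Or.inl ⟨by omega, Or.inl (by omega)⟩⟩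
    | exact Or.inr ⟨rfl, Or.inl ⟨by omega, Or.inr (by omega)⟩⟩
    | exact Or.inr ⟨rfl, Or.inr (Or.inl ⟨by omega, by omega⟩)⟩
    | exact Or.inr ⟨rfl, Or.inr (Or.inr (Or.inl ⟨by omega, by omega⟩))⟩
    | exact Or.inr ⟨rfl, Or.inr (Or.inr (Or.inr (Or.inl ⟨by omega, by omega⟩)))⟩
    | exact Or.inr ⟨rfl, Or.inr (Or.inr (Or.inr (Or.inr ⟨by omega, by omega⟩)))⟩

/-! ### Elimination of the exceptional pairs -/

section Exceptional

variable {G : Type*} [AddCommGroup G] [Finite G] {G₀ : Set G}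

omit [Finite G] in
theorem LengthsCongr.pair_cases {d : ℕ} (hc : LengthsCongr G₀ d) {n s : ℕ} (hn : 250 ≤ n)
    (hnd : n ≤ 5 * d) {g h : G} (hns : n = s * addOrderOf g) (hg : g ∈ G₀) (hh : h ∈ G₀) {j a : ℕ}
    (hj : 0 < j) (hmin : ∀ i : ℕ, i • h ∈ AddSubgroup.zmultiples g → j ∣ i) (hja : j • h = a • g)
    (ha : 0 < a) (ha' : a ≤ addOrderOf g) :
    a ∣ addOrderOf g ∨ IsLargeMinDistance n d ∨ s = 1 ∧ IsExceptionalPair n d a := by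
  by_cases hdvd : a ∣ addOrderOf g
  · exact Or.inl hdvd
  right
  set m := addOrderOf g
  have hr : 0 < m % a := Nat.pos_of_ne_zero fun h => hdvd (Nat.dvd_of_mod_eq_zero h)
  have hra := Nat.mod_lt m ha
  have hm : m = m / a * a + m % a := (Nat.div_add_mod' m a).symm
  have hq : 0 < m / a := Nat.div_pos ha' ha
  set q := m / a
  set r := m % a
  have h1 := Nat.div_mul_le_self (a - 1) r
  have h2 := Nat.lt_div_mul_add (a := a - 1) hr
  obtain ⟨c, hce⟩ : ∃ c, c = (a - 1) / r + 1 := ⟨_, rfl⟩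
  have hca : a ≤ c * r := by rw [hce, add_mul, one_mul]; omega
  have hca' : c * r < a + r := by rw [hce, add_mul, one_mul]; omega
  have hgap := (hasLengthGap_pair hj hmin hja hm hq hra hca hca').mono (G₁ := G₀) (by
    intro x hx
    rcases hx with rfl | rfl
    exacts [hg, hh])
  obtain ⟨k, hk⟩ := hc.dvd_of_hasLengthGap hgap
  exact isLargeMinDistance_or_isExceptionalPair hn hnd (by rw [hns, hm]) hq hr hra hca hca' hk

variable [IsAddCyclic G]

/-- Everything in `G₀` as a multiple of a generator `e ∈ G₀`. -/
theorem LengthsCongr.generator_cases {d : ℕ} (hc : LengthsCongr G₀ d) (hn : 250 ≤ Nat.card G)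
    (hnd : Nat.card G ≤ 5 * d) {e : G} (he : addOrderOf e = Nat.card G) (heG : e ∈ G₀) {x : G}
    (hx : x ∈ G₀) : ∃ b, 0 < b ∧ b ≤ Nat.card G ∧ b • e = x ∧
      (b ∣ Nat.card G ∨ IsLargeMinDistance (Nat.card G) d ∨ IsExceptionalPair (Nat.card G) d b) := by
  obtain ⟨j, a, hj, hmin, hja, ha, ha'⟩ := exists_index_nsmul e x
  have hj1 : j = 1 := Nat.dvd_one.1 (hmin 1 (by
    rw [one_smul]
    exact mem_zmultiples_of_addOrderOf_dvd (by rw [he]; exact addOrderOf_dvd_natCard x)))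
  have := hc.pair_cases hn hnd (s := 1) (by rw [he, one_mul]) heG hx hj hmin hja ha ha'
  rw [he] at this ha'
  refine ⟨a, ha, ha', by rw [← hja, hj1, one_smul], ?_⟩
  rcases this with h | h | h
  exacts [Or.inl h, Or.inr (Or.inl h), Or.inr (Or.inr h.2)]

omit [IsAddCyclic G] in
/-- A sequence that has index one with respect to `f` and index `t` with respect to `e`. -/
theorem LengthsCongr.dvd_index_sub_one {d : ℕ} (hc : LengthsCongr G₀ d) {e f : G} (heG : e ∈ G₀)
    {A : Multiset G} (hAG : ∀ g ∈ A, g ∈ G₀) {w v : G → ℕ} {t : ℕ}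
    (hw : ∀ g ∈ A, 0 < w g ∧ w g ≤ addOrderOf e ∧ w g • e = g)
    (ht : (A.map w).sum = addOrderOf e * t) (hv : ∀ g ∈ A, 0 < v g ∧ v g • f = g)
    (h1 : (A.map v).sum = addOrderOf f) : d ∣ t - 1 :=
  hc.dvd_of_hasLengthGap (hasLengthGap_of_index (addOrderOf_pos e) heG
    (isMinZeroSum_of_weight (addOrderOf_pos f) hv h1) hAG hw ht)

omit [IsAddCyclic G] in
-- The full power (ae)^(ord e) has index 1 with respect to ae and index a with respect to e.
theorem LengthsCongr.dvd_sub_one_of_coprime {d : ℕ} (hc : LengthsCongr G₀ d) {e : G} (heG : e ∈ G₀)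
    {a : ℕ} (ha : 0 < a) (ha' : a ≤ addOrderOf e) (hco : (addOrderOf e).Coprime a)
    (haG : a • e ∈ G₀) : d ∣ a - 1 := by
  have hord : addOrderOf (a • e) = addOrderOf e := Nat.Coprime.addOrderOf_nsmul hco
  refine hc.dvd_index_sub_one (f := a • e) heG (A := replicate (addOrderOf e) (a • e))
    (w := fun _ => a) (v := fun _ => 1) ?_ ?_ (by simp) ?_ (by simp [hord])
  · intro g hg
    rw [Multiset.eq_of_mem_replicate hg]; exact haG
  · intro g hg
    rw [Multiset.eq_of_mem_replicate hg]; exact ⟨ha, ha', rfl⟩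
  · intro g hg
    rw [Multiset.eq_of_mem_replicate hg]; simp

omit [Finite G] [IsAddCyclic G] in
theorem sub_nsmul_eq_neg {e : G} {a : ℕ} (ha : a ≤ addOrderOf e) :
    (addOrderOf e - a) • e = -(a • e) := by
  rw [eq_neg_iff_add_eq_zero, ← add_smul, Nat.sub_add_cancel ha, addOrderOf_nsmul_eq_zero]

/-- Besides 0, e and -e, only (n/2)e can lie in `G₀`. For n = 3d + 2 even this is impossible and
lengths agree modulo n - 2 = 3d; for n = 4d + 2 they agree modulo n/2 - 1 = 2d. Both contradict the
difference d. -/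
theorem LengthsCongr.false_of_neg_mem {d : ℕ} (hc : LengthsCongr G₀ d) (hgap : HasLengthGap G₀ d)
    (hn : 250 ≤ Nat.card G) {e : G} (he : addOrderOf e = Nat.card G)
    (heG : e ∈ G₀) (hneG : -e ∈ G₀)
    (hd : 3 * d + 2 = Nat.card G ∨ 4 * d + 2 = Nat.card G) : False := by
  set n := Nat.card G with hndef
  obtain ⟨w, -, hw⟩ := exists_discreteLog e
  obtain ⟨v, -, hv⟩ := exists_discreteLog (-e)
  have hneg : (n - 1) • e = -e := by
    have := sub_nsmul_eq_neg (e := e) (a := 1) (by omega)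
    rwa [he, one_smul] at this
  have hordn : addOrderOf (-e) = n := by rw [addOrderOf_neg, he]
  have hG : ∀ g ∈ G₀, g = 0 ∨ g = e ∨ g = -e ∨ ∃ b, n = 2 * b ∧ d ∣ b - 1 ∧ g = b • e := by
    intro x hx
    obtain ⟨b, hb, hbn, rfl, h⟩ := hc.generator_cases hn (by omega) he heG hx
    rcases h with hdvd | h | h
    · rcases hbn.eq_or_lt with hbn | hbn
      · left
        rw [hbn, ← hndef, ← he, addOrderOf_nsmul_eq_zero]
      · have hxn : (n - b) • (-e) = b • e := by
          have := sub_nsmul_eq_neg (e := -e) (a := b) (by omega)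
          rw [hordn] at this
          rw [this, smul_neg, neg_neg]
        have w1 : w (b • e) = b := hw b hb (by omega)
        have w2 : w (-e) = n - 1 := by rw [← hneg]; exact hw _ (by omega) (by omega)
        have v1 : v (b • e) = n - b := by rw [← hxn]; exact hv _ (by omega) (by omega)
        have v2 : v (-e) = 1 := by simpa using hv 1 (by omega) (by omega)
        have hA : ∀ g ∈ b • e ::ₘ replicate b (-e), g = b • e ∨ g = -e := by
          intro g hg
          rcases Multiset.mem_cons.1 hg with h | h
          exacts [Or.inl h, Or.inr (Multiset.eq_of_mem_replicate h)]
        -- The sequence (be)(-e)^b has index 1 with respect to -e and index b with respect to e.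
        have hdb : d ∣ b - 1 := by
          refine hc.dvd_index_sub_one (f := -e) heG (A := b • e ::ₘ replicate b (-e))
            (w := w) (v := v) ?_ ?_ ?_ ?_ ?_
          · intro g hg
            rcases hA g hg with rfl | rfl
            exacts [hx, hneG]
          · intro g hg
            rcases hA g hg with rfl | rfl
            · rw [w1]; exact ⟨hb, by omega, rfl⟩
            · rw [w2]; exact ⟨by omega, by omega, hneg⟩
          · rw [Multiset.map_cons, Multiset.map_replicate, Multiset.sum_cons,
              Multiset.sum_replicate, w1, w2, he, smul_eq_mul]
            zify [show 1 ≤ n by omega]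
            ring
          · intro g hg
            rcases hA g hg with rfl | rfl
            · rw [v1]; exact ⟨by omega, hxn⟩
            · rw [v2]; simp
          · rw [Multiset.map_cons, Multiset.map_replicate, Multiset.sum_cons,
              Multiset.sum_replicate, v1, v2, hordn, smul_eq_mul]
            omega
        rcases Nat.eq_or_lt_of_le (show 1 ≤ b from hb) with rfl | hb1
        · right; left; simp
        right; right; right
        obtain ⟨u, hu⟩ := hdvd
        obtain ⟨k, hk⟩ := id hdb
        have hbd := Nat.le_of_dvd (by omega) hdb
        have hu5 : u < 5 := by
          by_contra! h
          have := Nat.mul_le_mul_left b h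
          omega
        have hdn : d ∣ n - 2 := by
          rcases hd with h | h
          · exact ⟨3, by omega⟩
          · exact ⟨4, by omega⟩
        have hd49 : 49 < d := by omega
        -- With n = bu, both b - 1 and n - 2 = u(b-1) + (u-2) are multiples of d, so d ∣ u - 2 when
        -- u is 3 or 4; only u = 2 survives.
        interval_cases u
        · omega
        · omega
        · exact ⟨b, by omega, hdb, rfl⟩
        · have : d ∣ (n - 2) - 3 * (b - 1) := Nat.dvd_sub hdn (Dvd.dvd.mul_left hdb 3)
          have := Nat.le_of_dvd (by omega) this
          omega
        · have : d ∣ (n - 2) - 4 * (b - 1) := Nat.dvd_sub hdn (Dvd.dvd.mul_left hdb 4)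
          have := Nat.le_of_dvd (by omega) this
          omega
    · unfold IsLargeMinDistance at h; omega
    · unfold IsExceptionalPair at h
      have : b = n - 1 := by omega
      right; right; left
      rw [this, hneg]
  rcases hd with hd | hd
  · have hcong : LengthsCongr G₀ (n - 1 - 1) := by
      refine lengthsCongr_generator_nsmul (f := e) (c := 1) (by omega) one_pos (by omega) ?_
      intro g hg
      rw [hneg]
      rcases hG g hg with h | h | h | ⟨b, hb, ⟨k, hk⟩, -⟩
      · exact Or.inl h
      · exact Or.inr (Or.inl h)
      · exact Or.inr (Or.inr h)
      · have h3 : d * 3 = d * (2 * k) := by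
          rw [mul_left_comm, ← hk]; omega
        have := Nat.eq_of_mul_eq_mul_left (by omega) h3
        omega
    have := Nat.le_of_dvd (by omega) (hcong.dvd_of_hasLengthGap hgap)
    omega
  · have hcong : LengthsCongr G₀ (2 * d + 1 - 1) := by
      refine lengthsCongr_neg_half (e := e) (by omega) (by omega) ?_
      intro g hg
      rcases hG g hg with h | h | h | ⟨b, hb, -, hbe⟩
      · exact Or.inl h
      · exact Or.inr (Or.inl h)
      · exact Or.inr (Or.inr (Or.inl h))
      · have : b = 2 * d + 1 := by omega
        rw [this] at hbe
        exact Or.inr (Or.inr (Or.inr hbe))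
    have := Nat.le_of_dvd (by omega) (hcong.dvd_of_hasLengthGap hgap)
    omega

/-- For f = -2e and m = 2d + 1 one has e = mf and n = 2m + 1. Once `G₀` is confined to {0, f, mf},
lengths agree modulo m - 1 = 2d, which excludes the difference d. -/
theorem LengthsCongr.false_of_neg_two_nsmul_mem {d : ℕ} (hc : LengthsCongr G₀ d)
    (hgap : HasLengthGap G₀ d) (hn : 250 ≤ Nat.card G) {e : G} (he : addOrderOf e = Nat.card G)
    (heG : e ∈ G₀) (hfG : (Nat.card G - 2) • e ∈ G₀) (hd : 4 * d + 3 = Nat.card G) : False := by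
  set n := Nat.card G with hndef
  obtain ⟨m, hm⟩ : ∃ m, m = 2 * d + 1 := ⟨_, rfl⟩
  have hnm : n = 2 * m + 1 := by omega
  obtain ⟨f, hf⟩ : ∃ f, f = (n - 2) • e := ⟨_, rfl⟩
  rw [← hf] at hfG
  have hf2 : f = -(2 • e) := by
    have := sub_nsmul_eq_neg (e := e) (a := 2) (by omega)
    rwa [he, ← hf] at this
  have hne0 : n • e = 0 := by rw [← he, addOrderOf_nsmul_eq_zero]
  have hmf : m • f = e := by
    rw [hf2, smul_neg, ← mul_smul, neg_eq_iff_add_eq_zero, ← succ_nsmul,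
      show m * 2 + 1 = n by omega, hne0]
  have hordf : addOrderOf f = n := by
    rw [hf, Nat.Coprime.addOrderOf_nsmul, he]
    rw [he]
    have : n.Coprime 2 := Nat.coprime_two_right.2 ⟨m, hnm⟩
    exact (Nat.coprime_self_sub_right (show 2 ≤ n by omega)).2 this
  obtain ⟨w, -, hw⟩ := exists_discreteLog e
  obtain ⟨v, -, hv⟩ := exists_discreteLog f
  have we : w e = 1 := by simpa using hw 1 (by omega) (by omega)
  have wf : w f = n - 2 := by rw [hf]; exact hw _ (by omega) (by omega)
  have ve : v e = m := by
    have := hv m (by omega) (by omega)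
    rwa [hmf] at this
  have vf : v f = 1 := by simpa using hv 1 (by omega) (by omega)
  have hG : ∀ g ∈ G₀, g = 0 ∨ g = f ∨ g = m • f := by
    intro x hx
    rw [hmf]
    obtain ⟨b, hb, hbn, rfl, h⟩ := hc.generator_cases hn (by omega) he heG hx
    rcases h with hdvd | h | h
    · rcases hbn.eq_or_lt with hbn | hbn
      · exact Or.inl (hbn ▸ hne0)
      rcases Nat.eq_or_lt_of_le (show 1 ≤ b from hb) with rfl | hb1
      · right; right; simp
      exfalso
      obtain ⟨u, hu⟩ := hdvd
      have hbo : Odd b := by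
        have : Odd (b * u) := by rw [← hu]; exact ⟨m, hnm⟩
        exact (Nat.odd_mul.1 this).1
      have huo : Odd u := by
        have : Odd (b * u) := by rw [← hu]; exact ⟨m, hnm⟩
        exact (Nat.odd_mul.1 this).2
      obtain ⟨i, hi⟩ := hbo
      obtain ⟨l, hl⟩ := huo
      have h3b : 3 * b ≤ n := by
        have hl0 : l ≠ 0 := by rintro rfl; rw [hl] at hu; omega
        have := Nat.mul_le_mul_left b (show 3 ≤ u by omega)
        omega
      have hxf : (m - i) • f = b • e := by
        rw [hf2, smul_neg, ← mul_smul, neg_eq_iff_add_eq_zero, ← add_smul,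
          show (m - i) * 2 + b = n by omega, hne0]
      have wb : w (b • e) = b := hw b hb (by omega)
      have vb : v (b • e) = m - i := by rw [← hxf]; exact hv _ (by omega) (by omega)
      have hA : ∀ g ∈ b • e ::ₘ e ::ₘ replicate (i + 1) f, g = b • e ∨ g = e ∨ g = f := by
        intro g hg
        rcases Multiset.mem_cons.1 hg with h | h
        · exact Or.inl h
        rcases Multiset.mem_cons.1 h with h | h
        exacts [Or.inr (Or.inl h), Or.inr (Or.inr (Multiset.eq_of_mem_replicate h))]
      -- With b = 2i + 1, the sequence (be) · e · f^(i+1) has f-weight (m-i) + m + (i+1) = n and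
      -- index i + 1 with respect to e. But 0 < i < d because 3b ≤ n.
      have hdi : d ∣ i + 1 - 1 := by
        refine hc.dvd_index_sub_one (f := f) heG (A := b • e ::ₘ e ::ₘ replicate (i + 1) f)
          (w := w) (v := v) ?_ ?_ ?_ ?_ ?_
        · intro g hg
          rcases hA g hg with h | h | h <;> rw [h]
          exacts [hx, heG, hfG]
        · intro g hg
          rcases hA g hg with h | h | h <;> rw [h]
          · rw [wb]; exact ⟨hb, by omega, rfl⟩
          · rw [we]; exact ⟨one_pos, by omega, one_smul _ _⟩
          · rw [wf]; exact ⟨by omega, by omega, hf.symm⟩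
        · simp only [Multiset.map_cons, Multiset.map_replicate, Multiset.sum_cons,
            Multiset.sum_replicate, wb, we, wf, he, smul_eq_mul]
          rw [hi]
          zify [show 2 ≤ n by omega]
          ring
        · intro g hg
          rcases hA g hg with h | h | h <;> rw [h]
          · rw [vb]; exact ⟨by omega, hxf⟩
          · rw [ve]; exact ⟨by omega, hmf⟩
          · rw [vf]; exact ⟨one_pos, one_smul _ _⟩
        · simp only [Multiset.map_cons, Multiset.map_replicate, Multiset.sum_cons,
            Multiset.sum_replicate, vb, ve, vf, hordf, smul_eq_mul]
          omega
      have := Nat.le_of_dvd (by omega) hdi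
      omega
    · unfold IsLargeMinDistance at h; omega
    · unfold IsExceptionalPair at h
      rcases (by omega : b = n - 2 ∨ 2 * b + 1 = n) with rfl | h2
      · right; left; rw [hf]
      exfalso
      have hbm : b = m := by omega
      rw [hbm] at hx
      obtain ⟨y, hy⟩ : ∃ y, y = m • e := ⟨_, rfl⟩
      rw [← hy] at hx
      have hyf : 4 • y = f := by
        rw [hy, hf, ← mul_smul, show 4 * m = n + (n - 2) by omega, add_smul, hne0, zero_add]
      have hordy : addOrderOf y = n := by
        rw [hy, Nat.Coprime.addOrderOf_nsmul, he]
        rw [he, hnm]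
        simp
      have wy : w y = m := by rw [hy]; exact hw m (by omega) (by omega)
      obtain ⟨v, -, hv⟩ := exists_discreteLog y
      have vy : v y = 1 := by simpa using hv 1 (by omega) (by omega)
      have vf : v f = 4 := by rw [← hyf]; exact hv 4 (by omega) (by omega)
      have hA : ∀ g ∈ f ::ₘ replicate (n - 4) y, g = f ∨ g = y := by
        intro g hg
        rcases Multiset.mem_cons.1 hg with h | h
        exacts [Or.inl h, Or.inr (Multiset.eq_of_mem_replicate h)]
      -- For y = me one has 4y = f, so f · y^(n-4) has index 1 with respect to y; its index with
      -- respect to e is m - 1. Thus d would divide m - 2 = 2d - 1.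
      have hdm : d ∣ (m - 1) - 1 := by
        refine hc.dvd_index_sub_one (f := y) heG (A := f ::ₘ replicate (n - 4) y)
          (w := w) (v := v) ?_ ?_ ?_ ?_ ?_
        · intro g hg
          rcases hA g hg with h | h <;> rw [h]
          exacts [hfG, hx]
        · intro g hg
          rcases hA g hg with h | h <;> rw [h]
          · rw [wf]; exact ⟨by omega, by omega, hf.symm⟩
          · rw [wy]; exact ⟨by omega, by omega, hy.symm⟩
        · simp only [Multiset.map_cons, Multiset.map_replicate, Multiset.sum_cons,
            Multiset.sum_replicate, wf, wy, he, smul_eq_mul]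
          zify [show 2 ≤ n by omega, show 4 ≤ n by omega, show 1 ≤ m by omega]
          rw [hnm]
          push_cast
          ring
        · intro g hg
          rcases hA g hg with h | h <;> rw [h]
          · rw [vf]; exact ⟨by omega, hyf⟩
          · rw [vy]; exact ⟨one_pos, one_smul _ _⟩
        · simp only [Multiset.map_cons, Multiset.map_replicate, Multiset.sum_cons,
            Multiset.sum_replicate, vf, vy, hordy, smul_eq_mul]
          omega
      have h4 : d ∣ 2 * d - ((m - 1) - 1) := Nat.dvd_sub (Dvd.intro_left 2 rfl) hdm
      have := Nat.le_of_dvd (by omega) h4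
      omega
  have hcong := lengthsCongr_generator_nsmul (f := f) (m := m) (c := 2) (by omega) two_pos
    (by omega) hG
  have := Nat.le_of_dvd (by omega) (hcong.dvd_of_hasLengthGap hgap)
  omega

theorem isLargeMinDistance_of_lengthsCongr {d : ℕ} (hd : 0 < d) (hc : LengthsCongr G₀ d)
    (hgap : HasLengthGap G₀ d) (hn : 250 ≤ Nat.card G) (hnd : Nat.card G ≤ 5 * d) :
    IsLargeMinDistance (Nat.card G) d := by
  by_contra hnot
  by_cases hP : PairwiseDivisor G₀
  · have h1 := hP.lt_two_mul_card_divisors hd hc hgap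
    have h2 := ten_mul_card_divisors_le hn
    omega
  · simp only [PairwiseDivisor, not_forall] at hP
    obtain ⟨e, heG, h, hhG, j, a, hj, hmin, hja, ha, ha', hdvd⟩ := hP
    obtain ⟨s, hs⟩ := addOrderOf_dvd_natCard e
    rcases hc.pair_cases hn hnd (s := s) (by rw [hs, mul_comm]) heG hhG hj hmin hja ha ha' with
      h1 | h1 | ⟨rfl, h1⟩
    · exact hdvd h1
    · exact hnot h1
    rw [mul_one] at hs
    have hj1 : j = 1 := Nat.dvd_one.1 (hmin 1 (by
      rw [one_smul]
      exact mem_zmultiples_of_addOrderOf_dvd (by rw [← hs]; exact addOrderOf_dvd_natCard h)))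
    rw [hj1, one_smul] at hja
    subst hja
    rcases h1 with ⟨h1, h2⟩ | ⟨h1, h2⟩ | ⟨h1, h2⟩ | ⟨h1, h2⟩ | ⟨h1, h2⟩
    · refine hc.false_of_neg_mem hgap hn hs.symm heG ?_ h2
      have := sub_nsmul_eq_neg (e := e) (a := 1) (by omega)
      rw [one_smul] at this
      rwa [← this, show addOrderOf e - 1 = a by omega]
    · exact hc.false_of_neg_two_nsmul_mem hgap hn hs.symm heG
        (by rwa [show Nat.card G - 2 = a by omega]) h2
    -- The roles are swapped: for n = 2a + 1 the element ae is a generator and e = -2(ae).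
    · have hord : addOrderOf (a • e) = Nat.card G := by
        rw [Nat.Coprime.addOrderOf_nsmul, hs]
        rw [← hs, ← h1]
        simp
      refine hc.false_of_neg_two_nsmul_mem hgap hn hord hhG ?_ h2
      have h3 : (Nat.card G - 2) * a = 1 + Nat.card G * (a - 1) := by
        rw [← h1]
        zify [show 2 ≤ 2 * a + 1 by omega, show 1 ≤ a from ha]
        ring
      rw [← mul_smul, h3, add_smul, mul_comm, mul_smul, hs, addOrderOf_nsmul_eq_zero, smul_zero,
        one_smul, add_zero]
      exact heG
    -- Here a = 3d + 2 is prime to n = a + 3, so d divides a - 1 = 3d + 1, hence 1. In the last case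
    -- a = 4d + 3 is odd, n = a + 4, and d would divide 2.
    · have hco : (addOrderOf e).Coprime a := by
        rw [← hs, ← h1, Nat.coprime_comm, Nat.coprime_self_add_right,
          Nat.coprime_comm, Nat.Prime.coprime_iff_not_dvd Nat.prime_three]
        omega
      have h3 := hc.dvd_sub_one_of_coprime heG ha ha' hco hhG
      have h4 : d ∣ (a - 1) - 3 * d := Nat.dvd_sub h3 (Dvd.intro_left 3 rfl)
      have := Nat.le_of_dvd (by omega) h4
      omega
    · have hco : (addOrderOf e).Coprime a := by
        rw [← hs, ← h1, Nat.coprime_comm, Nat.coprime_self_add_right,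
          Nat.coprime_comm, show 4 = 2 ^ 2 by rfl]
        apply Nat.Coprime.pow_left
        rw [Nat.Prime.coprime_iff_not_dvd Nat.prime_two]
        omega
      have h3 := hc.dvd_sub_one_of_coprime heG ha ha' hco hhG
      have h4 : d ∣ (a - 1) - 4 * d := Nat.dvd_sub h3 (Dvd.intro_left 4 rfl)
      have := Nat.le_of_dvd (by omega) h4
      omega

theorem exists_addOrderOf_eq_of_mul_eq_card {s h : ℕ} (hs : s * h = Nat.card G) :
    ∃ f : G, addOrderOf f = h := by
  obtain ⟨e, he⟩ := IsAddCyclic.exists_generator (α := G)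
  have hord : addOrderOf e = Nat.card G := addOrderOf_eq_card_of_forall_mem_zmultiples he
  have hpos : 0 < Nat.card G := Nat.card_pos
  have hs0 : s ≠ 0 := by rintro rfl; omega
  refine ⟨s • e, ?_⟩
  rw [addOrderOf_nsmul_of_dvd hs0 ⟨h, by rw [hord, hs]⟩, hord, ← hs]
  exact Nat.mul_div_cancel_left h (Nat.pos_of_ne_zero hs0)

/-- The ten equations are n = s(c(d+1) + 1) with sc ≤ 4, eight cases, and n = 2s(d+1) with s ≤ 2; s
is the index of the subgroup used. -/
theorem IsLargeMinDistance.mem_groupMinDistances {d : ℕ} (hd : 0 < d)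
    (h : IsLargeMinDistance (Nat.card G) d) : d ∈ groupMinDistances G := by
  have odd_case : ∀ s c : ℕ, 0 < c → s * (c * (d + 1) + 1) = Nat.card G →
      d ∈ groupMinDistances G := by
    intro s c hc0 hs
    obtain ⟨f, hf⟩ := exists_addOrderOf_eq_of_mul_eq_card hs
    exact sub_one_mem_groupMinDistances_of_modEq_one (m := d + 1) (by omega) hc0 hf
  have even_case : ∀ s : ℕ, s * (2 * (d + 1)) = Nat.card G → d ∈ groupMinDistances G := by
    intro s hs
    obtain ⟨f, hf⟩ := exists_addOrderOf_eq_of_mul_eq_card hs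
    exact sub_one_mem_groupMinDistances_of_even (u := d + 1) (by omega) hf
  rcases h with h | h | h | h | h | h | h | h | h | h
  · exact odd_case 1 1 one_pos (by omega)
  · exact even_case 1 (by omega)
  · exact odd_case 1 2 (by omega) (by omega)
  · exact odd_case 2 1 one_pos (by omega)
  · exact odd_case 1 3 (by omega) (by omega)
  · exact odd_case 3 1 one_pos (by omega)
  · exact even_case 2 (by omega)
  · exact odd_case 1 4 (by omega) (by omega)
  · exact odd_case 2 2 (by omega) (by omega)
  · exact odd_case 4 1 one_pos (by omega)

end Exceptional

/-! ### The list of values as rational numbers, and the theorem -/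

theorem natCast_eq_sub_div_iff (n d t c : ℕ) (hc : 0 < c) :
    (d : ℚ) = ((n : ℚ) - t) / c ↔ c * d + t = n := by
  have hc' : (c : ℚ) ≠ 0 := by positivity
  rw [eq_div_iff hc', eq_sub_iff_add_eq, mul_comm]
  exact_mod_cast Iff.rfl

theorem isLargeMinDistance_iff_rat (n d : ℕ) :
    IsLargeMinDistance n d ↔ (d : ℚ) ∈
        ({(n : ℚ) - 2, ((n : ℚ) - 2) / 2, ((n : ℚ) - 3) / 2, ((n : ℚ) - 4) / 2,
          ((n : ℚ) - 4) / 3, ((n : ℚ) - 6) / 3, ((n : ℚ) - 4) / 4, ((n : ℚ) - 5) / 4,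
          ((n : ℚ) - 6) / 4, ((n : ℚ) - 8) / 4} : Set ℚ) := by
  have h1 := natCast_eq_sub_div_iff n d 2 1 (by omega)
  have h2 := natCast_eq_sub_div_iff n d 2 2 (by omega)
  have h3 := natCast_eq_sub_div_iff n d 3 2 (by omega)
  have h4 := natCast_eq_sub_div_iff n d 4 2 (by omega)
  have h5 := natCast_eq_sub_div_iff n d 4 3 (by omega)
  have h6 := natCast_eq_sub_div_iff n d 6 3 (by omega)
  have h7 := natCast_eq_sub_div_iff n d 4 4 (by omega)
  have h8 := natCast_eq_sub_div_iff n d 5 4 (by omega)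
  have h9 := natCast_eq_sub_div_iff n d 6 4 (by omega)
  have h10 := natCast_eq_sub_div_iff n d 8 4 (by omega)
  push_cast at h1 h2 h3 h4 h5 h6 h7 h8 h9 h10
  rw [div_one, one_mul] at h1
  simp only [IsLargeMinDistance, Set.mem_insert_iff, Set.mem_singleton_iff, h1, h2, h3, h4, h5, h6,
    h7, h8, h9, h10]

end Factorization

theorem mainTheorem2 {G : Type*} [AddCommGroup G] [Finite G] [IsAddCyclic G]
    (n : ℕ) (hcard : Nat.card G = n) (hn : 250 ≤ n) :
    Factorization.groupMinDistances G ∩ {d : ℕ | (n : ℚ) / 5 ≤ (d : ℚ)} =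
      {d : ℕ | 0 < d ∧ (d : ℚ) ∈
        ({(n : ℚ) - 2, ((n : ℚ) - 2) / 2, ((n : ℚ) - 3) / 2, ((n : ℚ) - 4) / 2,
          ((n : ℚ) - 4) / 3, ((n : ℚ) - 6) / 3, ((n : ℚ) - 4) / 4, ((n : ℚ) - 5) / 4,
          ((n : ℚ) - 6) / 4, ((n : ℚ) - 8) / 4} : Set ℚ)} := by
  subst hcard
  ext d
  have hle : ((Nat.card G : ℕ) : ℚ) / 5 ≤ (d : ℚ) ↔ Nat.card G ≤ 5 * d := by
    rw [div_le_iff₀ (by norm_num), mul_comm]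
    exact_mod_cast Iff.rfl
  rw [Set.mem_inter_iff, Set.mem_ofPred_eq, Set.mem_ofPred_eq, hle, ← Factorization.isLargeMinDistance_iff_rat]
  constructor
  · rintro ⟨hd, hnd⟩
    obtain ⟨G₀, hd0, hc, hgap⟩ := Factorization.mem_groupMinDistances_iff.1 hd
    exact ⟨hd0, Factorization.isLargeMinDistance_of_lengthsCongr hd0 hc hgap hn hnd⟩
  · rintro ⟨hd0, h⟩
    refine ⟨h.mem_groupMinDistances hd0, ?_⟩
    unfold Factorization.IsLargeMinDistance at h
    omega
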